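/- Let $n\ge 2$, let $M^n$ be a smooth closed manifold, let $U\subseteq(0,\infty)$ be open and let $\Phi:U\to\mathbb R$ be smooth with $\Phi'(x)>0$ and $\Phi''(x)\ge -\frac{2\Phi'(x)}{x}$ for all $x\in U$. Let $X:M^n\times[0,T)\to\mathbb R^{n+1}$ be a smooth family of immersions with outer unit normal $\nu$ that solves the $\Phi(H)$-flow $$\partial_t X=-\Phi(H)\,\nu ,$$ the mean curvature $H$ taking its values in $U$. Here $g_{ij}=\langle\partial_iX,\partial_jX\rangle$, $h_{ij}=-\langle\partial_i\partial_jX,\nu\rangle$, $\mathscr W=\{h_i^j\}$ with $h_i^j=h_{ik}g^{kj}$ is the Weingarten map, $H=h_i^i$ and $|A|^2=h_i^jh_j^i$. Suppose that all hypersurfaces $M_t=X(M,t)$ are strictly convex, that is, all eigenvalues of $\mathscr W$ are positive. Let $\nabla$ be the Levi-Civita connection of $g(t)$, let $\Delta_{\dot\Phi}=\Phi'(H)\,g^{kl}\nabla_k\nabla_l$, and let $\{b_i^j\}=\mathscr W^{-1}$, so that $b_i^kh_k^j=\delta_i^j$. Then, in arbitrary local coordinates on $M$ and for all $t\in[0,T)$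 (with one-sided time derivative at $t=0$, and with $\Phi,\Phi',\Phi''$ evaluated at $H$), $$\partial_t b_i^j=\Delta_{\dot\Phi}b_i^j-2\Phi'\,(\nabla^kb_i^p)\,h_p^q\,(\nabla_kb_q^j)-\Phi''\,(b_i^p\nabla_pH)(\nabla^qH\,b_q^j)+(\Phi'H-\Phi)\,\delta_i^j-\Phi'|A|^2\,b_i^j ,$$ and $$\partial_t b_i^j\le\Delta_{\dot\Phi}b_i^j+(\Phi'H-\Phi)\,\delta_i^j-\Phi'|A|^2\,b_i^j ,$$ where the inequality is between $g(t)$-self-adjoint endomorphisms: the right side minus the left side, with its upper index lowered by $g$, is a symmetric positive semidefinite bilinear form. -/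

import Mathlib

open Set Matrix
open scoped Manifold ContDiff

noncomputable section

namespace PhiFlow

/-- The Euclidean space of dimension `m`. -/
abbrev E (m : ℕ) : Type := EuclideanSpace ℝ (Fin m)

/-- The `i`-th partial derivative of `f` at `x`. -/
def pd {n : ℕ} {F : Type*} [NormedAddCommGroup F] [NormedSpace ℝ F]
    (i : Fin n) (f : E n → F) (x : E n) : F :=
  fderiv ℝ f x (EuclideanSpace.single i 1)

section Local

/-! Extrinsic geometry of a hypersurface in local coordinates: `Y` is a local parametrisation
and `N` its unit normal field. In a matrix that stands for a tensor of type (1,1) the row is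
the lower index and the column is the upper index. -/

variable {n : ℕ} (Y N : E n → E (n + 1))

/-- The induced metric `g_ij = ⟨∂_i Y, ∂_j Y⟩`. -/
def metric (x : E n) : Matrix (Fin n) (Fin n) ℝ :=
  Matrix.of fun i j => inner ℝ (pd i Y x) (pd j Y x)

/-- The second fundamental form `h_ij = -⟨∂_i ∂_j Y, N⟩` (which is also `⟨∂_i N, ∂_j Y⟩`);
it is positive on a round sphere with outer normal `N`. -/
def secondFF (x : E n) : Matrix (Fin n) (Fin n) ℝ :=
  Matrix.of fun i j => -inner ℝ (pd i (pd j Y) x) (N x)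

/-- The Weingarten map `h_i^j = h_ik g^kj`. -/
def weingarten (x : E n) : Matrix (Fin n) (Fin n) ℝ :=
  secondFF Y N x * (metric Y x)⁻¹

/-- The mean curvature `H = h_i^i`. -/
def meanCurv (x : E n) : ℝ := (weingarten Y N x).trace

/-- The total curvature `|A|² = h_i^j h_j^i`. -/
def normSqA (x : E n) : ℝ := (weingarten Y N x * weingarten Y N x).trace

/-- `lam` is a principal curvature: an eigenvalue of the Weingarten map,
`v^i h_i^j = lam v^j` for some tangent vector `v ≠ 0`. -/
def IsPrincipalCurvature (x : E n) (lam : ℝ) : Prop :=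
  ∃ v : Fin n → ℝ, v ≠ 0 ∧ v ᵥ* weingarten Y N x = lam • v

/-- The inverse Weingarten map `b_i^j`, with `b_i^k h_k^j = δ_i^j`. -/
def invWeingarten (x : E n) : Matrix (Fin n) (Fin n) ℝ := (weingarten Y N x)⁻¹

/-- The Christoffel symbols `Γ_ij^k` of the induced metric. -/
def christoffel (k i j : Fin n) (x : E n) : ℝ :=
  (1 / 2) * ∑ l, (metric Y x)⁻¹ k l *
    (pd i (fun y => metric Y y j l) x + pd j (fun y => metric Y y i l) x
      - pd l (fun y => metric Y y i j) x)

/-- The covariant derivative `∇_k S_i^j` of a tensor of type (1,1). -/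
def covDeriv (S : E n → Matrix (Fin n) (Fin n) ℝ) (k : Fin n) (x : E n) :
    Matrix (Fin n) (Fin n) ℝ :=
  Matrix.of fun i j => pd k (fun y => S y i j) x
    - ∑ l, christoffel Y l k i x * S x l j
    + ∑ l, christoffel Y j k l x * S x i l

/-- The second covariant derivative `∇_l ∇_k S_i^j` of a tensor of type (1,1). -/
def covDeriv₂ (S : E n → Matrix (Fin n) (Fin n) ℝ) (l k : Fin n) (x : E n) :
    Matrix (Fin n) (Fin n) ℝ :=
  Matrix.of fun i j => pd l (fun y => covDeriv Y S k y i j) x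
    - ∑ m, christoffel Y m l k x * covDeriv Y S m x i j
    - ∑ m, christoffel Y m l i x * covDeriv Y S k x m j
    + ∑ m, christoffel Y j l m x * covDeriv Y S k x i m

/-- The operator `Δ_Φ = (∂Φ(H)/∂h_kl) ∇_k ∇_l = Φ'(H) g^kl ∇_k ∇_l` on tensors of
type (1,1). -/
def phiLaplacian (Φ : ℝ → ℝ) (S : E n → Matrix (Fin n) (Fin n) ℝ) (x : E n) :
    Matrix (Fin n) (Fin n) ℝ :=
  Matrix.of fun i j =>
    ∑ k, ∑ l, (deriv Φ (meanCurv Y N x) * (metric Y x)⁻¹ k l) * covDeriv₂ Y S k l x i j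

/-- The gradient term `(∇^k b_i^p) h_p^q (∇_k b_q^j)`. -/
def gradTermB (x : E n) : Matrix (Fin n) (Fin n) ℝ :=
  Matrix.of fun i j => ∑ k, ∑ l, ∑ p, ∑ q, (metric Y x)⁻¹ k l *
    covDeriv Y (invWeingarten Y N) l x i p * weingarten Y N x p q *
      covDeriv Y (invWeingarten Y N) k x q j

/-- The gradient `∇^q H = g^ql ∂_l H`. -/
def gradH (q : Fin n) (x : E n) : ℝ :=
  ∑ l, (metric Y x)⁻¹ q l * pd l (meanCurv Y N) x

/-- The gradient term `(b_i^p ∇_p H) (∇^q H b_q^j)`. -/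
def gradTermH (x : E n) : Matrix (Fin n) (Fin n) ℝ :=
  Matrix.of fun i j =>
    (∑ p, invWeingarten Y N x i p * pd p (meanCurv Y N) x) *
      (∑ q, gradH Y N q x * invWeingarten Y N x q j)

/-- `Δ_Φ b + (Φ' H - Φ) δ - Φ' |A|² b`. -/
def reactionDiffusion (Φ : ℝ → ℝ) (x : E n) : Matrix (Fin n) (Fin n) ℝ :=
  phiLaplacian Y N Φ (invWeingarten Y N) x
    + (deriv Φ (meanCurv Y N x) * meanCurv Y N x - Φ (meanCurv Y N x)) •
        (1 : Matrix (Fin n) (Fin n) ℝ)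
    - (deriv Φ (meanCurv Y N x) * normSqA Y N x) • invWeingarten Y N x

end Local

section Flow

variable {n : ℕ} {M : Type*} [TopologicalSpace M] [ChartedSpace (E n) M]

/-- A smooth chart of `M`: a member of the maximal smooth atlas. -/
def IsSmoothChart (e : OpenPartialHomeomorph M (E n)) : Prop :=
  e ∈ IsManifold.maximalAtlas (𝓡 n) ∞ M

/-- The map `f` on `M` in the coordinates of the chart `e`. -/
def inChart {F : Type*} (e : OpenPartialHomeomorph M (E n)) (f : M → F) : E n → F :=
  fun x => f (e.symm x)

/-- `X` is a solution of `∂_t X = -Φ(H) ν` on `M × [0, T)` by smooth immersions, with unit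
normal field `ν`, where `Φ` is a function on `U`. The mean curvature is computed in local
coordinates; the time derivative at `t = 0` is one-sided. -/
structure IsPhiFlow (Φ : ℝ → ℝ) (U : Set ℝ) (T : ℝ) (X ν : ℝ → M → E (n + 1)) : Prop where
  smooth : ContMDiffOn (𝓘(ℝ, ℝ).prod (𝓡 n)) 𝓘(ℝ, E (n + 1)) ∞
    (fun q : ℝ × M => X q.1 q.2) (Ico 0 T ×ˢ univ)
  smooth_normal : ContMDiffOn (𝓘(ℝ, ℝ).prod (𝓡 n)) 𝓘(ℝ, E (n + 1)) ∞
    (fun q : ℝ × M => ν q.1 q.2) (Ico 0 T ×ˢ univ)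
  immersion : ∀ t ∈ Ico 0 T, ∀ p : M,
    Function.Injective (mfderiv (𝓡 n) 𝓘(ℝ, E (n + 1)) (X t) p)
  unit_normal : ∀ t ∈ Ico 0 T, ∀ p : M, ‖ν t p‖ = 1
  normal : ∀ t ∈ Ico 0 T, ∀ p : M, ∀ v : TangentSpace (𝓡 n) p,
    inner ℝ (E := E (n + 1)) (mfderiv (𝓡 n) 𝓘(ℝ, E (n + 1)) (X t) p v) (ν t p) = 0
  meanCurv_mem : ∀ t ∈ Ico 0 T, ∀ e : OpenPartialHomeomorph M (E n), IsSmoothChart e →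
    ∀ p ∈ e.source, meanCurv (inChart e (X t)) (inChart e (ν t)) (e p) ∈ U
  flow : ∀ t ∈ Ico 0 T, ∀ e : OpenPartialHomeomorph M (E n), IsSmoothChart e →
    ∀ p ∈ e.source, HasDerivWithinAt (fun s => X s p)
      (-(Φ (meanCurv (inChart e (X t)) (inChart e (ν t)) (e p)) • ν t p)) (Ico 0 T) t

/-- The immersed hypersurface `X` with unit normal `ν` is strictly convex: all principal
curvatures are positive. The sign convention for the second fundamental form then makes `ν`
the outer normal when `M` is closed. -/
def IsStrictlyConvex (X ν : M → E (n + 1)) : Prop :=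
  ∀ e : OpenPartialHomeomorph M (E n), IsSmoothChart e → ∀ p ∈ e.source, ∀ lam : ℝ,
    IsPrincipalCurvature (inChart e X) (inChart e ν) (e p) lam → 0 < lam

end Flow

end PhiFlow

end

/-! The Weingarten map W satisfies a reaction-diffusion equation. Inverting it gives the equation
for b, and the inequality drops gradient terms whose sign comes from Codazzi and Cauchy–Schwarz.

A normal variation -φν gives ∂_t W = (Hess φ) g⁻¹ + φ W² (`evolution_W`). For φ = Φ(H) the Hessian
is Φ' Hess H + Φ'' dH ⊗ dH, and `simons_identity` replaces (Hess H) g⁻¹ by ΔW - H W² + |A|² W. Then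
∂_t b = -b (∂_t W) b, while Δb is -b (ΔW) b plus twice the gradient term of b (`lap_inv`); this is
`evolution_inv`.

For the inequality, ∇b = -b (∇W) b turns the lowered gradient terms into the congruence by b of 2Φ'
g^kl A_l h⁻¹ A_k + Φ'' dH ⊗ dH, where A_k = ∇_k h. Fix a vector η. By Codazzi the matrix Z with rows
A_k η is symmetric with g-trace ∇_η H, and `trace_sq_le` gives tr(g⁻¹ Z h⁻¹ Z) ≥ (tr g⁻¹ Z)² / H.
The form at η is therefore at least (2Φ'/H + Φ'') (∇_η H)², which is nonnegative by the hypothesis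
on Φ''.

The tensor identities are pure algebra over a commutative ring with commuting derivations
(`Hypersurface`). The ring used is that of smooth functions on time interval × chart domain, with
derivatives taken within this set, so that t = 0 needs no separate argument. Evaluation at a point
is a ring homomorphism and carries the identities to the coordinate expressions of the statement
(`IsSlice`). -/

noncomputable section

namespace PhiFlow

/-! ### Entrywise derivations of matrices. -/

section MatrixDerivation

variable {R : Type*} [CommRing R] [Algebra ℝ R] {l m n : Type*} [Fintype m]

theorem derivation_map_mul (D : Derivation ℝ R R) (A : Matrix l m R) (B : Matrix m n R) :
    (A * B).map D = A.map D * B + A * B.map D := by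
  ext i j
  simp only [map_apply, mul_apply, map_sum, Derivation.leibniz, smul_eq_mul, Matrix.add_apply,
    ← Finset.sum_add_distrib]
  exact Finset.sum_congr rfl fun k _ => by ring

theorem derivation_map_add (D : Derivation ℝ R R) (A B : Matrix l n R) :
    (A + B).map D = A.map D + B.map D := by
  ext i j; simp

theorem derivation_map_sub (D : Derivation ℝ R R) (A B : Matrix l n R) :
    (A - B).map D = A.map D - B.map D := by
  ext i j; simp

omit [Fintype m] in
theorem derivation_map_one [DecidableEq m] (D : Derivation ℝ R R) :
    (1 : Matrix m m R).map D = 0 := by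
  ext i j
  by_cases h : i = j <;> simp [h]

theorem derivation_map_comm {D D' : Derivation ℝ R R} (h : ∀ f, D (D' f) = D' (D f))
    (A : Matrix l n R) : (A.map D').map D = (A.map D).map D' := by
  ext i j; simp [h]

theorem derivation_map_trace (D : Derivation ℝ R R) (A : Matrix m m R) :
    (A.map D).trace = D A.trace := by
  simp [Matrix.trace]

theorem derivation_map_inv [DecidableEq m] (D : Derivation ℝ R R) {A B : Matrix m m R}
    (h : A * B = 1) (h' : B * A = 1) : B.map D = -(B * A.map D * B) := by
  have h1 := derivation_map_mul D A B
  rw [h, derivation_map_one] at h1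
  have h2 : B * (A.map D * B + A * B.map D) = 0 := by rw [← h1, mul_zero]
  rw [mul_add, ← mul_assoc, ← mul_assoc, h', one_mul] at h2
  exact eq_neg_of_add_eq_zero_right h2

end MatrixDerivation

/-! ### Algebraic hypersurface theory: frame, Gauss and Weingarten formulas, Codazzi. -/

/-- A hypersurface `x` with unit normal `ν` over an algebra `R` of functions of the coordinates
in the index set `ι`, where `d i` is the `i`-th partial derivative. -/
structure Hypersurface (R ι κ : Type*) [CommRing R] [Algebra ℝ R] [Fintype ι] [DecidableEq ι]
    [Fintype κ] where
  d : ι → Derivation ℝ R R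
  d_comm : ∀ i j f, d i (d j f) = d j (d i f)
  x : κ → R
  ν : κ → R
  normal : ∀ i, ∑ a, d i (x a) * ν a = 0
  unit : ∑ a, ν a * ν a = 1
  isUnit_metric : IsUnit (Matrix.det (Matrix.of fun i j => ∑ a, d i (x a) * d j (x a)))
  codim_one : Nonempty (ι ⊕ Unit ≃ κ)

namespace Hypersurface

variable {R ι κ : Type*} [CommRing R] [Algebra ℝ R] [Fintype ι] [DecidableEq ι] [Fintype κ]
  (F : Hypersurface R ι κ)

/-- The coordinate tangent vectors. -/
def J : Matrix ι κ R := Matrix.of fun i a => F.d i (F.x a)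

/-- The induced metric. -/
def G : Matrix ι ι R := Matrix.of fun i j => ∑ a, F.d i (F.x a) * F.d j (F.x a)

/-- The inverse of the induced metric. -/
def Gi : Matrix ι ι R := F.G⁻¹

/-- The second fundamental form. -/
def h : Matrix ι ι R := Matrix.of fun i j => -∑ a, F.d i (F.d j (F.x a)) * F.ν a

/-- The Weingarten map. -/
def W : Matrix ι ι R := F.h * F.Gi

/-- The mean curvature. -/
def H : R := F.W.trace

/-- The connection matrices: `F.Γ k i l` is the Christoffel symbol `Γ_ki^l`. -/
def Γ (k : ι) : Matrix ι ι R := Matrix.of fun i l => algebraMap ℝ R (1 / 2) * ∑ m, F.Gi l m *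
  (F.d k (F.G i m) + F.d i (F.G k m) - F.d m (F.G k i))

/-- The covariant derivative in direction `k` of the lower and upper index of a tensor of
type (1,1). -/
def D (k : ι) (S : Matrix ι ι R) : Matrix ι ι R := S.map (F.d k) - F.Γ k * S + S * F.Γ k

/-- The second covariant derivative of a tensor of type (1,1). -/
def D₂ (k l : ι) (S : Matrix ι ι R) : Matrix ι ι R :=
  F.D k (F.D l S) - ∑ m, F.Γ k l m • F.D m S

/-- The Hessian of a function. -/
def hess (f : R) : Matrix ι ι R :=
  Matrix.of fun i j => F.d i (F.d j f) - ∑ m, F.Γ i j m * F.d m f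

/-- The gradient of a function, with upper index. -/
def grad (f : R) : ι → R := (fun i => F.d i f) ᵥ* F.Gi

/-- The rough Laplacian of a tensor of type (1,1). -/
def lap (S : Matrix ι ι R) : Matrix ι ι R := ∑ k, ∑ l, F.Gi k l • F.D₂ k l S

theorem G_mul_Gi : F.G * F.Gi = 1 := Matrix.mul_nonsing_inv _ F.isUnit_metric

theorem Gi_mul_G : F.Gi * F.G = 1 := Matrix.nonsing_inv_mul _ F.isUnit_metric

theorem G_eq : F.G = F.J * F.Jᵀ := by
  ext i j; simp [G, J, mul_apply]

theorem G_transpose : F.Gᵀ = F.G := by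
  rw [G_eq, transpose_mul, transpose_transpose]

theorem Gi_transpose : F.Giᵀ = F.Gi := by
  rw [Gi, transpose_nonsing_inv, G_transpose]

theorem Gi_symm (i j : ι) : F.Gi i j = F.Gi j i := by
  conv_lhs => rw [← F.Gi_transpose, transpose_apply]

theorem h_transpose : F.hᵀ = F.h := by
  ext i j
  simp only [h, transpose_apply, of_apply, F.d_comm i j]

theorem J_mulVec_ν : F.J *ᵥ F.ν = 0 := by
  ext i; simpa [J, mulVec, dotProduct] using F.normal i

theorem ν_dot_ν : F.ν ⬝ᵥ F.ν = 1 := F.unit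

theorem J_map_apply (k i : ι) (a : κ) : F.J.map (F.d k) i a = F.J.map (F.d i) k a := by
  simp [J, F.d_comm k i]

theorem h_row (k : ι) : F.h k = -(F.J.map (F.d k) *ᵥ F.ν) := by
  ext j; simp [h, J, mulVec, dotProduct]

theorem two_mul_half (r : R) : algebraMap ℝ R (1 / 2) * (2 * r) = r := by
  rw [← mul_assoc, ← map_ofNat (algebraMap ℝ R) 2, ← map_mul]
  norm_num

theorem eq_zero_of_two_mul {r : R} (hr : 2 * r = 0) : r = 0 := by
  rw [← two_mul_half r, hr, mul_zero]

/-- When the three derivatives of the metric are expanded, everything cancels except two copies of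
⟨∂_k ∂_i x, ∂_m x⟩. So Γ_k collects the tangential coordinates of ∂_k ∂_i x. -/
theorem Γ_eq (k : ι) : F.Γ k = F.J.map (F.d k) * F.Jᵀ * F.Gi := by
  ext i l
  rw [mul_apply, Γ, of_apply, Finset.mul_sum]
  refine Finset.sum_congr rfl fun m _ => ?_
  have key : F.d k (F.G i m) + F.d i (F.G k m) - F.d m (F.G k i)
      = 2 * ((F.J.map (F.d k) * F.Jᵀ) i m) := by
    simp only [G, of_apply, map_sum, Derivation.leibniz, smul_eq_mul, mul_apply, map_apply, J,
      transpose_apply, Finset.mul_sum, ← Finset.sum_add_distrib, ← Finset.sum_sub_distrib]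
    refine Finset.sum_congr rfl fun a _ => ?_
    rw [F.d_comm i k, F.d_comm m k, F.d_comm m i]
    ring
  rw [key, mul_left_comm, two_mul_half, F.Gi_symm, mul_comm]

theorem Γ_symm (k i l : ι) : F.Γ k i l = F.Γ i k l := by
  rw [Γ_eq, Γ_eq, Matrix.mul_assoc, Matrix.mul_assoc, mul_apply, mul_apply]
  exact Finset.sum_congr rfl fun a _ => by rw [J_map_apply]

/-- The tangent vectors and the normal form a frame of the ambient space. -/
theorem completeness [DecidableEq κ] :
    F.Jᵀ * F.Gi * F.J + vecMulVec F.ν F.ν = 1 := by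
  obtain ⟨e⟩ := F.codim_one
  let P : Matrix (ι ⊕ Unit) κ R := Matrix.fromRows F.J (Matrix.of fun _ => F.ν)
  let Q : Matrix κ (ι ⊕ Unit) R := Matrix.fromCols (F.Jᵀ * F.Gi) (Matrix.of fun a _ => F.ν a)
  have hPQ : P * Q = 1 := by
    have h1 : F.J * (Matrix.of fun a (_ : Unit) => F.ν a) = 0 := by
      ext i u; simpa [mulVec, dotProduct, mul_apply] using congrFun F.J_mulVec_ν i
    have h2 : (Matrix.of fun (_ : Unit) => F.ν) * F.Jᵀ = 0 := by
      rw [← transpose_eq_zero, transpose_mul, transpose_transpose]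
      exact h1
    have h3 : (Matrix.of fun (_ : Unit) => F.ν) * (Matrix.of fun a (_ : Unit) => F.ν a) = 1 := by
      ext u v; simpa [mul_apply] using F.unit
    rw [Matrix.fromRows_mul_fromCols, h1, h3, ← Matrix.mul_assoc, ← Matrix.mul_assoc, h2, ← G_eq,
      G_mul_Gi, Matrix.zero_mul, fromBlocks_one]
  -- The codimension is one, so P and Q are square up to reindexing and a right inverse is a left
  -- inverse.
  have hQP : Q * P = 1 := (Matrix.mul_eq_one_comm_of_equiv e).mp hPQ
  rw [Matrix.fromCols_mul_fromRows] at hQP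
  rw [← hQP]
  congr 1
  ext a b; simp [mul_apply, vecMulVec_apply]

theorem eq_tangential_add_normal {l : Type*} (A : Matrix l κ R) :
    A = A * F.Jᵀ * F.Gi * F.J + vecMulVec (A *ᵥ F.ν) F.ν := by
  classical
  rw [← mul_vecMulVec, Matrix.mul_assoc, Matrix.mul_assoc, ← Matrix.mul_add, ← Matrix.mul_assoc,
    completeness, Matrix.mul_one]

/-- The tangential coordinates of a combination of the frame. -/
theorem tangential_coord {l : Type*} (A : Matrix l ι R) (u : l → R) :
    (A * F.J + vecMulVec u F.ν) * F.Jᵀ * F.Gi = A := by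
  have : F.ν ᵥ* F.Jᵀ = 0 := by rw [vecMul_transpose, J_mulVec_ν]
  have h0 : vecMulVec u (0 : ι → R) = 0 := by ext; simp [vecMulVec_apply]
  rw [Matrix.add_mul, vecMulVec_mul, this, Matrix.mul_assoc A, ← G_eq, h0, add_zero,
    Matrix.mul_assoc, G_mul_Gi, Matrix.mul_one]

/-- The formula of Gauss for the derivatives of the tangent vectors. -/
theorem gauss_formula (k : ι) :
    F.J.map (F.d k) = F.Γ k * F.J + vecMulVec (-F.h k) F.ν := by
  conv_lhs => rw [F.eq_tangential_add_normal (F.J.map (F.d k))]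
  rw [← Γ_eq, h_row, neg_neg]

theorem derivation_ν_dot_ν (D : Derivation ℝ R R) : ∑ a, D (F.ν a) * F.ν a = 0 := by
  have h1 := congrArg D F.unit
  rw [map_sum, Derivation.map_one_eq_zero] at h1
  refine eq_zero_of_two_mul ?_
  rw [← h1, Finset.mul_sum]
  exact Finset.sum_congr rfl fun a _ => by rw [Derivation.leibniz, smul_eq_mul]; ring

theorem derivation_ν_dot_J (D : Derivation ℝ R R) (i : ι) :
    ∑ a, D (F.ν a) * F.J i a = -∑ a, D (F.J i a) * F.ν a := by
  have h1 := congrArg D (F.normal i)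
  rw [map_sum, map_zero] at h1
  rw [eq_neg_iff_add_eq_zero, ← h1, ← Finset.sum_add_distrib]
  exact Finset.sum_congr rfl fun a _ => by
    rw [Derivation.leibniz, smul_eq_mul, smul_eq_mul, J, of_apply]; ring

/-- The formula of Weingarten for the derivatives of the normal. -/
theorem weingarten_formula : (Matrix.of fun k a => F.d k (F.ν a)) = F.W * F.J := by
  conv_lhs => rw [F.eq_tangential_add_normal (Matrix.of fun k a => F.d k (F.ν a))]
  have h1 : (Matrix.of fun k a => F.d k (F.ν a)) *ᵥ F.ν = 0 := by
    ext k; simpa [mulVec, dotProduct] using F.derivation_ν_dot_ν (F.d k)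
  have h2 : (Matrix.of fun k a => F.d k (F.ν a)) * F.Jᵀ = F.h := by
    ext k i
    simpa [mul_apply, h, J] using F.derivation_ν_dot_J (F.d k) i
  rw [h1, h2, zero_vecMulVec, add_zero, W]

theorem d_ν (k : ι) (a : κ) : F.d k (F.ν a) = (F.W k ᵥ* F.J) a :=
  congrFun (congrFun F.weingarten_formula k) a

/-- Each side is the tangential part of a second derivative of ν, computed from ∂ν = W J and the
Gauss formula; second derivatives commute. -/
theorem weingarten_row_symm (k l : ι) :
    (F.W.map (F.d k) + F.W * F.Γ k) l = (F.W.map (F.d l) + F.W * F.Γ l) k := by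
  have key : ∀ k, (F.W * F.J).map (F.d k) * F.Jᵀ * F.Gi = F.W.map (F.d k) + F.W * F.Γ k := by
    intro k
    rw [derivation_map_mul, gauss_formula, Matrix.mul_add, mul_vecMulVec, ← add_assoc,
      ← Matrix.mul_assoc, ← Matrix.add_mul, tangential_coord]
  rw [← key, ← key, ← weingarten_formula, Matrix.mul_assoc, Matrix.mul_assoc]
  ext j
  rw [mul_apply, mul_apply]
  exact Finset.sum_congr rfl fun a _ => by simp [F.d_comm k l]

/-- The equation of Codazzi. -/
theorem codazzi (k i j : ι) : F.D k F.W i j = F.D i F.W k j := by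
  have h1 := congrFun (F.weingarten_row_symm k i) j
  have h2 : (F.Γ k * F.W) i j = (F.Γ i * F.W) k j := by
    rw [mul_apply, mul_apply]
    exact Finset.sum_congr rfl fun m _ => by rw [Γ_symm]
  simp only [Matrix.add_apply] at h1
  simp only [D, Matrix.add_apply, Matrix.sub_apply]
  linear_combination h1 - h2

/-! ### Curvature, the Ricci identity and compatibility with the metric. -/

/-- The curvature of the connection. -/
def curv (l k : ι) : Matrix ι ι R :=
  (F.Γ k).map (F.d l) - (F.Γ l).map (F.d k) + F.Γ k * F.Γ l - F.Γ l * F.Γ k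

/-- The equation of Gauss. -/
theorem gauss_equation (l k : ι) :
    F.curv l k = vecMulVec (F.h k) (F.W l) - vecMulVec (F.h l) (F.W k) := by
  -- Tangential coordinates of the third derivatives ∂_l ∂_k ∂_i x, from differentiating the Gauss
  -- formula; the W term comes from ∂_l ν. Antisymmetrising in l and k gives the claim.
  have key : ∀ l k, (F.J.map (F.d k)).map (F.d l) * F.Jᵀ * F.Gi
      = (F.Γ k).map (F.d l) + F.Γ k * F.Γ l - vecMulVec (F.h k) (F.W l) := by
    intro l k
    have h1 : (vecMulVec (-F.h k) F.ν).map (F.d l)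
        = vecMulVec (fun i => F.d l (-F.h k i)) F.ν + vecMulVec (-F.h k) (F.W l) * F.J := by
      rw [vecMulVec_mul]
      ext i a
      simp only [map_apply, vecMulVec_apply, Derivation.leibniz, smul_eq_mul, Matrix.add_apply,
        d_ν, Pi.neg_apply]
      ring
    rw [gauss_formula, derivation_map_add, derivation_map_mul, gauss_formula, h1, Matrix.mul_add,
      mul_vecMulVec, ← Matrix.mul_assoc, ← F.tangential_coord (_ + _ - _)
        (F.Γ k *ᵥ (-F.h l) + fun i => F.d l (-F.h k i)), neg_vecMulVec, Matrix.sub_mul,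
      Matrix.add_mul _ _ F.J, Matrix.neg_mul, add_vecMulVec]
    congr 2
    abel
  have h1 := key l k
  have h2 := key k l
  rw [derivation_map_comm (F.d_comm l k), h2] at h1
  rw [curv, ← sub_eq_zero, ← sub_eq_zero.mpr h1.symm]
  abel

theorem D_mul (k : ι) (S T : Matrix ι ι R) : F.D k (S * T) = F.D k S * T + S * F.D k T := by
  simp only [D, derivation_map_mul]
  noncomm_ring

theorem D_one (k : ι) : F.D k 1 = 0 := by
  simp [D, derivation_map_one]

theorem D_add (k : ι) (S T : Matrix ι ι R) : F.D k (S + T) = F.D k S + F.D k T := by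
  simp only [D, derivation_map_add]
  noncomm_ring

theorem D_trace (k : ι) (S : Matrix ι ι R) : (F.D k S).trace = F.d k S.trace := by
  rw [D, trace_add, trace_sub, trace_mul_comm, derivation_map_trace, sub_add_cancel]

/-- The Ricci identity. -/
theorem ricci_identity (l k : ι) (S : Matrix ι ι R) :
    F.D₂ l k S - F.D₂ k l S = S * F.curv l k - F.curv l k * S := by
  have h1 : ∑ m, F.Γ l k m • F.D m S = ∑ m, F.Γ k l m • F.D m S :=
    Finset.sum_congr rfl fun m _ => by rw [Γ_symm]
  have h2 := derivation_map_comm (F.d_comm l k) S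
  rw [D₂, D₂, h1, sub_sub_sub_cancel_right]
  simp only [D, curv, derivation_map_add, derivation_map_sub, derivation_map_mul, h2]
  noncomm_ring

/-- Metric compatibility ∇g = 0: the two terms are the two halves of the product rule for J Jᵀ. -/
theorem G_map (k : ι) : F.G.map (F.d k) = F.Γ k * F.G + F.G * (F.Γ k)ᵀ := by
  have h1 : F.Γ k * F.G = F.J.map (F.d k) * F.Jᵀ := by
    rw [Γ_eq, Matrix.mul_assoc, Gi_mul_G, Matrix.mul_one]
  have h2 : F.G * (F.Γ k)ᵀ = F.J * (F.Jᵀ).map (F.d k) := by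
    rw [← F.G_transpose, ← transpose_mul, h1, transpose_mul, transpose_transpose]
    rfl
  rw [h1, h2, ← derivation_map_mul, ← G_eq]

theorem Gi_map (k : ι) : F.Gi.map (F.d k) = -(F.Gi * F.Γ k) - (F.Γ k)ᵀ * F.Gi := by
  rw [derivation_map_inv (F.d k) F.G_mul_Gi F.Gi_mul_G, G_map, mul_add, add_mul, mul_assoc,
    mul_assoc (F.Γ k), G_mul_Gi, ← mul_assoc F.Gi F.G, Gi_mul_G]
  simp [sub_eq_add_neg, add_comm]

theorem Gi_mul_W_transpose : (F.Gi * F.W)ᵀ = F.Gi * F.W := by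
  rw [W, transpose_mul, transpose_mul, h_transpose, Gi_transpose, mul_assoc]

/-- Raising an index commutes with ∇ because ∇g⁻¹ = 0, so ∇_k W with both indices up inherits the
symmetry of W. -/
theorem Gi_mul_D_W_transpose (k : ι) : (F.Gi * F.D k F.W)ᵀ = F.Gi * F.D k F.W := by
  have h1 := derivation_map_mul (F.d k) F.Gi F.W
  rw [Gi_map] at h1
  have h2 : F.Gi * F.D k F.W
      = (F.Gi * F.W).map (F.d k) + ((F.Γ k)ᵀ * (F.Gi * F.W) + (F.Gi * F.W) * F.Γ k) := by
    rw [h1, D]; noncomm_ring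
  have h3 : ((F.Gi * F.W).map (F.d k))ᵀ = (F.Gi * F.W).map (F.d k) := by
    rw [← transpose_map, Gi_mul_W_transpose]
  rw [h2, transpose_add, transpose_add, transpose_mul, transpose_mul (F.Gi * F.W),
    Gi_mul_W_transpose, transpose_transpose, h3, add_comm ((F.Γ k)ᵀ * _)]

/-- The divergence of the Weingarten map is the gradient of the mean curvature. -/
theorem div_W (j : ι) : ∑ k, ∑ l, F.Gi k l * F.D k F.W l j = F.grad F.H j := by
  have h1 : ∀ k, ∑ l, F.Gi k l * F.D k F.W l j = ∑ l, F.Gi j l * F.D l F.W k k := by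
    intro k
    have := congrFun (congrFun (F.Gi_mul_D_W_transpose k) k) j
    rw [transpose_apply, mul_apply, mul_apply] at this
    rw [← this]
    exact Finset.sum_congr rfl fun l _ => by rw [codazzi]
  simp_rw [h1]
  rw [Finset.sum_comm, grad, vecMul, dotProduct]
  refine Finset.sum_congr rfl fun l _ => ?_
  rw [← Finset.mul_sum, F.Gi_symm, mul_comm, H, ← D_trace]
  rfl

/-- The covariant derivative of a gradient is the Hessian. -/
theorem grad_map (f : R) (i : ι) :
    (fun j => F.d i (F.grad f j)) + F.grad f ᵥ* F.Γ i = F.hess f i ᵥ* F.Gi := by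
  have h1 : (fun j => F.d i (F.grad f j))
      = (fun l => F.d i (F.d l f)) ᵥ* F.Gi + (fun l => F.d l f) ᵥ* F.Gi.map (F.d i) := by
    ext j
    simp only [grad, vecMul, dotProduct, map_sum, Derivation.leibniz, smul_eq_mul, Pi.add_apply,
      map_apply, ← Finset.sum_add_distrib]
    exact Finset.sum_congr rfl fun l _ => by ring
  have h2 : F.hess f i = (fun l => F.d i (F.d l f)) - (fun l => F.d l f) ᵥ* (F.Γ i)ᵀ := by
    ext l
    simp [hess, vecMul, dotProduct, mul_comm]
  rw [h1, h2, Gi_map, grad, vecMul_vecMul, vecMul_sub, vecMul_neg, sub_vecMul, vecMul_vecMul]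
  abel

/-! ### Simons' identity. -/

theorem D₂_apply (k l : ι) (S : Matrix ι ι R) (i j : ι) :
    F.D₂ k l S i j = F.d k (F.D l S i j) - ∑ m, F.Γ k l m * F.D m S i j
      - ∑ m, F.Γ k i m * F.D l S m j + ∑ m, F.D l S i m * F.Γ k m j := by
  rw [D₂, D]
  simp only [Matrix.sub_apply, Matrix.add_apply, map_apply, mul_apply, Matrix.sum_apply,
    Matrix.smul_apply, smul_eq_mul]
  ring

/-- The covariant derivative of the Codazzi equation; Codazzi is applied to the leading term and to
each Christoffel correction. -/
theorem D₂_W_symm (k l i j : ι) : F.D₂ k l F.W i j = F.D₂ k i F.W l j := by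
  have h1 : ∑ m, F.Γ k i m * F.D l F.W m j = ∑ m, F.Γ k i m * F.D m F.W l j :=
    Finset.sum_congr rfl fun m _ => by rw [F.codazzi l m j]
  have h2 : ∑ m, F.Γ k l m * F.D i F.W m j = ∑ m, F.Γ k l m * F.D m F.W i j :=
    Finset.sum_congr rfl fun m _ => by rw [F.codazzi i m j]
  have h3 : ∑ m, F.D l F.W i m * F.Γ k m j = ∑ m, F.D i F.W l m * F.Γ k m j :=
    Finset.sum_congr rfl fun m _ => by rw [F.codazzi l i m]
  rw [D₂_apply, D₂_apply, h1, h2, h3, F.codazzi l i j]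
  ring

/-- Contraction with g⁻¹ passes through ∇_i, so this is ∇_i of div W = grad H, that is, the Hessian
of H with an index raised. -/
theorem sum_D₂_W (i j : ι) :
    ∑ k, ∑ l, F.Gi k l * F.D₂ i k F.W l j = (F.hess F.H * F.Gi) i j := by
  have h1 := congrFun (F.grad_map F.H i) j
  have h2 : F.grad F.H = fun j => ∑ k, ∑ l, F.Gi k l * F.D k F.W l j :=
    funext fun j => (F.div_W j).symm
  have h3 : (F.hess F.H * F.Gi) i j = (F.hess F.H i ᵥ* F.Gi) j := rfl
  have h4 : ∀ k l, F.d i (F.Gi k l) = -(∑ m, F.Gi k m * F.Γ i m l) - ∑ m, F.Γ i m k * F.Gi m l := by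
    intro k l
    have := congrFun (congrFun (F.Gi_map i) k) l
    simpa [mul_apply] using this
  rw [h3, ← h1, Pi.add_apply, h2]
  simp only [map_sum, Derivation.leibniz, smul_eq_mul, h4, D₂_apply, vecMul, dotProduct]
  -- The two terms of ∂_i g^kl cancel the Christoffel corrections on the contracted indices k (`e1`)
  -- and l (`e2`). The correction on j (`e3`) is the one belonging to grad H.
  have e1 : ∑ k, ∑ l, F.Gi k l * ∑ m, F.Γ i k m * F.D m F.W l j
      = ∑ k, ∑ l, F.D k F.W l j * ∑ m, F.Γ i m k * F.Gi m l := by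
    simp only [Finset.mul_sum]
    rw [Finset.sum_congr rfl fun k _ => Finset.sum_comm, Finset.sum_comm,
      Finset.sum_congr rfl fun k _ => Finset.sum_comm]
    refine Finset.sum_congr rfl fun k _ => Finset.sum_congr rfl fun l _ =>
      Finset.sum_congr rfl fun m _ => by ring
  have e2 : ∑ k, ∑ l, F.Gi k l * ∑ m, F.Γ i l m * F.D k F.W m j
      = ∑ k, ∑ l, F.D k F.W l j * ∑ m, F.Gi k m * F.Γ i m l := by
    simp only [Finset.mul_sum]
    refine Finset.sum_congr rfl fun k _ => ?_
    rw [Finset.sum_comm]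
    refine Finset.sum_congr rfl fun l _ => Finset.sum_congr rfl fun m _ => by ring
  have e3 : ∑ k, ∑ l, F.Gi k l * ∑ m, F.D k F.W l m * F.Γ i m j
      = ∑ m, (∑ k, ∑ l, F.Gi k l * F.D k F.W l m) * F.Γ i m j := by
    simp only [Finset.mul_sum, Finset.sum_mul]
    rw [Finset.sum_congr rfl fun k _ => Finset.sum_comm, Finset.sum_comm]
    refine Finset.sum_congr rfl fun k _ => Finset.sum_congr rfl fun l _ =>
      Finset.sum_congr rfl fun m _ => by ring
  rw [← e3]
  simp only [mul_add, mul_sub, mul_neg, Finset.sum_add_distrib, Finset.sum_sub_distrib,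
    Finset.sum_neg_distrib]
  rw [e1, e2]
  ring

theorem trace_Gi_W_h : ∑ k, ∑ l, F.Gi k l * (F.W * F.h) l k = (F.W * F.W).trace := by
  have : ∑ k, ∑ l, F.Gi k l * (F.W * F.h) l k = (F.Gi * (F.W * F.h)).trace := by
    simp [Matrix.trace, mul_apply]
  rw [this, trace_mul_comm, mul_assoc, ← W]

/-- The identity of Simons. -/
theorem simons_identity :
    F.lap F.W = F.hess F.H * F.Gi + F.H • (F.W * F.W) - (F.W * F.W).trace • F.W := by
  -- Codazzi swaps l with i, the Ricci identity swaps the two derivatives, and the Gauss equation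
  -- expresses the curvature by h and W.
  have h1 : ∀ k l i j, F.D₂ k l F.W i j = F.D₂ i k F.W l j
      + ((F.W * F.h) l i * F.W k j - (F.W * F.h) l k * F.W i j)
      - (F.h i l * (F.W * F.W) k j - F.h k l * (F.W * F.W) i j) := by
    intro k l i j
    have h2 := congrFun (congrFun (F.ricci_identity k i F.W) l) j
    rw [gauss_equation, mul_sub, sub_mul, mul_vecMulVec, mul_vecMulVec, vecMulVec_mul,
      vecMulVec_mul] at h2
    have h3 : ∀ i, (F.W *ᵥ F.h i) l = (F.W * F.h) l i := by
      intro i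
      conv_rhs => rw [← F.h_transpose]
      rfl
    have h4 : ∀ i, (F.W i ᵥ* F.W) j = (F.W * F.W) i j := fun i => rfl
    simp only [Matrix.sub_apply, vecMulVec_apply, h3, h4] at h2
    have h5 : ∀ i, F.h i l = F.h l i := fun i => by
      conv_lhs => rw [← F.h_transpose, transpose_apply]
    rw [D₂_W_symm, h5, h5 k]
    rw [h5, h5 k] at h2
    linear_combination h2
  have e1 : ∀ i j, ∑ k, ∑ l, F.Gi k l * ((F.W * F.h) l i * F.W k j)
      = (F.W * F.W * F.W) i j := by
    intro i j
    have h2 : F.W * F.W * F.W = (F.Gi * (F.W * F.h))ᵀ * F.W := by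
      rw [← mul_assoc, transpose_mul, Gi_mul_W_transpose, h_transpose, ← mul_assoc, ← W]
    have h3 : ∀ k, (F.Gi * (F.W * F.h)) k i = ∑ l, F.Gi k l * (F.W * F.h) l i :=
      fun k => Matrix.mul_apply
    rw [h2, Matrix.mul_apply]
    simp only [transpose_apply, h3, Finset.sum_mul, mul_assoc]
  have e2 : ∀ i j, ∑ k, ∑ l, F.Gi k l * (F.h i l * (F.W * F.W) k j)
      = (F.W * F.W * F.W) i j := by
    intro i j
    have h2 : F.W * F.W * F.W = (F.h * F.Gi) * (F.W * F.W) := mul_assoc _ _ _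
    have h3 : ∀ k, (F.h * F.Gi) i k = ∑ l, F.h i l * F.Gi l k := fun k => Matrix.mul_apply
    rw [h2, Matrix.mul_apply]
    simp only [h3, Finset.sum_mul]
    refine Finset.sum_congr rfl fun k _ => Finset.sum_congr rfl fun l _ => ?_
    rw [F.Gi_symm k l]; ring
  have e3 : ∑ k, ∑ l, F.Gi k l * F.h k l = F.H := by
    rw [H, W, Matrix.trace]
    simp only [diag_apply, mul_apply]
    refine Finset.sum_congr rfl fun k _ => Finset.sum_congr rfl fun l _ => ?_
    rw [F.Gi_symm k l]; ring
  ext i j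
  have h6 : F.lap F.W i j = ∑ k, ∑ l, F.Gi k l * F.D₂ k l F.W i j := by
    simp [lap, Matrix.sum_apply]
  rw [h6]
  simp only [h1 _ _ i j, mul_add, mul_sub, Finset.sum_add_distrib, Finset.sum_sub_distrib, e1, e2,
    sum_D₂_W]
  simp only [← mul_assoc, ← Finset.sum_mul, e3, trace_Gi_W_h]
  simp only [Matrix.sub_apply, Matrix.add_apply, Matrix.smul_apply, smul_eq_mul]
  ring

/-! ### Normal variations. -/

/-- The evolution of the Weingarten map under a normal variation. -/
theorem evolution_W {τ : Derivation ℝ R R} (hτ : ∀ i f, τ (F.d i f) = F.d i (τ f)) {φ : R}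
    (hx : ∀ a, τ (F.x a) = -(φ * F.ν a)) :
    F.W.map τ = F.hess φ * F.Gi + φ • (F.W * F.W) := by
  have hJ : F.J.map τ = (-φ • F.W) * F.J + vecMulVec (fun i => -F.d i φ) F.ν := by
    ext i a
    have := F.d_ν i a
    simp only [map_apply, J, of_apply, hτ, hx, map_neg, Derivation.leibniz, smul_eq_mul,
      Matrix.add_apply, vecMulVec_apply, smul_mul, Matrix.smul_apply]
    rw [this]
    simp only [J, vecMul, dotProduct, mul_apply, of_apply]
    ring
  have hν : ∀ a, τ (F.ν a) = (F.grad φ ᵥ* F.J) a := by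
    have h1 := F.eq_tangential_add_normal (Matrix.of fun (_ : Unit) a => τ (F.ν a))
    have h2 : (Matrix.of fun (_ : Unit) a => τ (F.ν a)) *ᵥ F.ν = 0 := by
      ext k; simpa [mulVec, dotProduct] using F.derivation_ν_dot_ν τ
    have h3 : (Matrix.of fun (_ : Unit) a => τ (F.ν a)) * F.Jᵀ
        = Matrix.of fun _ i => F.d i φ := by
      ext u i
      have h4 := F.derivation_ν_dot_J τ i
      have h5 := congrFun (congrArg (fun A => A *ᵥ F.ν) hJ) i
      simp only [add_mulVec, ← mulVec_mulVec, J_mulVec_ν, mulVec_zero, vecMulVec_mulVec,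
        ν_dot_ν] at h5
      simp only [mulVec, dotProduct, map_apply] at h5
      rw [h5] at h4
      simpa [mul_apply] using h4
    rw [h2, h3, zero_vecMulVec, add_zero] at h1
    exact fun a => congrFun (congrFun h1 ()) a
  -- The tangential part of τ(∂_i ν) is computed twice: here by the product rule for W J, in `h2` by
  -- commuting τ past ∂_i and differentiating τν = grad φ.
  have h1 : (F.W * F.J).map τ * F.Jᵀ * F.Gi = F.W.map τ - φ • (F.W * F.W) := by
    rw [derivation_map_mul, hJ, Matrix.mul_add, mul_vecMulVec, ← add_assoc, ← Matrix.mul_assoc,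
      ← Matrix.add_mul, tangential_coord, Matrix.mul_smul, neg_smul, sub_eq_add_neg]
  have h2 : (F.W * F.J).map τ
      = (F.hess φ * F.Gi) * F.J + vecMulVec (fun i => -(F.grad φ ⬝ᵥ F.h i)) F.ν := by
    rw [← weingarten_formula]
    ext i a
    have h3 := congrArg (fun v => (v ᵥ* F.J) a) (F.grad_map φ i)
    have h4 := congrArg (fun A => (F.grad φ ᵥ* A) a) (F.gauss_formula i)
    have h5 : ((F.hess φ * F.Gi) * F.J) i a = ((F.hess φ i ᵥ* F.Gi) ᵥ* F.J) a := rfl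
    simp only [vecMul_add, add_vecMul, vecMul_vecMulVec, vecMul_vecMul, Pi.add_apply] at h3 h4
    rw [Matrix.add_apply, h5, vecMul_vecMul, ← h3]
    have h6 : F.d i ((F.grad φ ᵥ* F.J) a) = ((fun j => F.d i (F.grad φ j)) ᵥ* F.J) a
        + (F.grad φ ᵥ* F.J.map (F.d i)) a := by
      simp only [vecMul, dotProduct, map_sum, Derivation.leibniz, smul_eq_mul, map_apply,
        ← Finset.sum_add_distrib]
      exact Finset.sum_congr rfl fun l _ => by ring
    rw [map_apply, of_apply, hτ, hν, h6, h4]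
    simp only [vecMulVec_apply, Pi.smul_apply, smul_eq_mul, dotProduct_neg]
    simp
    ring
  rw [h2, tangential_coord] at h1
  rw [h1, sub_add_cancel]

theorem hess_comp {φ φ' φ'' f : R} (h1 : ∀ i, F.d i φ = φ' * F.d i f)
    (h2 : ∀ i, F.d i φ' = φ'' * F.d i f) :
    F.hess φ = φ' • F.hess f + φ'' • vecMulVec (fun i => F.d i f) fun i => F.d i f := by
  ext i j
  simp only [hess, of_apply, h1, h2, Derivation.leibniz, smul_eq_mul, Matrix.add_apply,
    Matrix.smul_apply, vecMulVec_apply, mul_sub, Finset.mul_sum, mul_left_comm φ']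
  ring

theorem D_neg (k : ι) (S : Matrix ι ι R) : F.D k (-S) = -F.D k S := by
  have := F.D_add k S (-S)
  rw [add_neg_cancel] at this
  have h0 : F.D k 0 = 0 := by simpa using F.D_add k 0 0
  rw [h0] at this
  exact (neg_eq_of_add_eq_zero_right this.symm).symm

/-! ### The inverse Weingarten map. -/

section Inverse

variable {B : Matrix ι ι R} (hB : B * F.W = 1) (hB' : F.W * B = 1)
include hB hB'

theorem D_inv (k : ι) : F.D k B = -(B * F.D k F.W * B) := by
  have h1 := F.D_mul k B F.W
  rw [hB, D_one] at h1
  have h2 : (F.D k B * F.W + B * F.D k F.W) * B = 0 := by rw [← h1, zero_mul]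
  rw [add_mul, mul_assoc, hB', mul_one] at h2
  exact eq_neg_of_add_eq_zero_left h2

/-- A second differentiation of -B (∇W) B hits both outer factors. Inserting B W = 1 writes the
resulting quadratic terms as ∇B W ∇B. -/
theorem D₂_inv (k l : ι) : F.D₂ k l B = -(B * F.D₂ k l F.W * B)
    + (F.D k B * F.W * F.D l B + F.D l B * F.W * F.D k B) := by
  have h1 : ∀ k l, F.D k B * F.W * F.D l B = B * F.D k F.W * B * F.D l F.W * B := by
    intro k l
    calc F.D k B * F.W * F.D l B
        = B * F.D k F.W * (B * F.W) * B * F.D l F.W * B := by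
          rw [F.D_inv hB hB', F.D_inv hB hB']; noncomm_ring
      _ = _ := by rw [hB, mul_one]
  have h2 : F.D k (F.D l B) = B * F.D k F.W * B * F.D l F.W * B
      - B * F.D k (F.D l F.W) * B + B * F.D l F.W * B * F.D k F.W * B := by
    rw [F.D_inv hB hB' l, D_neg, D_mul, D_mul, F.D_inv hB hB' k]
    noncomm_ring
  have h3 : ∑ m, F.Γ k l m • F.D m B = -(B * (∑ m, F.Γ k l m • F.D m F.W) * B) := by
    rw [Finset.mul_sum, Finset.sum_mul, ← Finset.sum_neg_distrib]
    refine Finset.sum_congr rfl fun m _ => ?_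
    rw [F.D_inv hB hB', Matrix.mul_smul, Matrix.smul_mul, smul_neg]
  rw [D₂, h2, h3, h1, h1, D₂, mul_sub, sub_mul]
  abel

/-- Symmetry of g⁻¹ makes the two orders of the quadratic term equal, hence the factor 2. -/
theorem lap_inv : F.lap B = -(B * F.lap F.W * B)
    + (2 : R) • ∑ k, ∑ l, F.Gi k l • (F.D l B * F.W * F.D k B) := by
  have h1 : ∑ k, ∑ l, F.Gi k l • (F.D k B * F.W * F.D l B)
      = ∑ k, ∑ l, F.Gi k l • (F.D l B * F.W * F.D k B) := by
    rw [Finset.sum_comm]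
    exact Finset.sum_congr rfl fun k _ => Finset.sum_congr rfl fun l _ => by rw [F.Gi_symm]
  simp only [lap, F.D₂_inv hB hB', smul_add, Finset.sum_add_distrib, h1, smul_neg,
    Finset.sum_neg_distrib, Finset.mul_sum, Finset.sum_mul, Matrix.mul_smul, Matrix.smul_mul,
    two_smul]

/-- The evolution of the inverse Weingarten map. -/
theorem evolution_inv {τ : Derivation ℝ R R} (hτ : ∀ i f, τ (F.d i f) = F.d i (τ f))
    {φ φ' φ'' : R} (hx : ∀ a, τ (F.x a) = -(φ * F.ν a))
    (h1 : ∀ i, F.d i φ = φ' * F.d i F.H) (h2 : ∀ i, F.d i φ' = φ'' * F.d i F.H) :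
    B.map τ = φ' • F.lap B + (φ' * F.H - φ) • (1 : Matrix ι ι R)
      - (φ' * (F.W * F.W).trace) • B
      - (2 * φ') • ∑ k, ∑ l, F.Gi k l • (F.D l B * F.W * F.D k B)
      - φ'' • vecMulVec (B *ᵥ fun i => F.d i F.H) (F.grad F.H ᵥ* B) := by
  -- Simons' identity solved for the Hessian; conjugating W² by B gives the identity (`h4`), the
  -- source of the δ term.
  have h3 : F.hess F.H * F.Gi = F.lap F.W - F.H • (F.W * F.W) + (F.W * F.W).trace • F.W := by
    rw [simons_identity]; abel
  have h4 : B * (F.W * F.W) * B = 1 := by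
    rw [← mul_assoc, hB, one_mul, hB']
  have h5 : B * vecMulVec (fun i => F.d i F.H) (F.grad F.H) * B
      = vecMulVec (B *ᵥ fun i => F.d i F.H) (F.grad F.H ᵥ* B) := by
    rw [mul_vecMulVec, vecMulVec_mul]
  have h6 : B * F.lap F.W * B
      = (2 : R) • ∑ k, ∑ l, F.Gi k l • (F.D l B * F.W * F.D k B) - F.lap B := by
    rw [F.lap_inv hB hB']; abel
  rw [derivation_map_inv τ hB' hB, F.evolution_W hτ hx, F.hess_comp h1 h2, add_mul,
    Matrix.smul_mul, h3, Matrix.smul_mul, vecMulVec_mul, ← grad]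
  simp only [mul_add, add_mul, mul_sub, sub_mul, Matrix.mul_smul, Matrix.smul_mul, h4, h5, h6, hB,
    one_mul, smul_add, smul_sub]
  module

end Inverse

end Hypersurface

/-! ### Positivity of the gradient terms. -/

section LinearAlgebra

open scoped MatrixOrder

variable {ι : Type*} [Fintype ι] [DecidableEq ι]

/-- With P = LᵀL, an eigenvector w of the symmetric matrix L h Lᵀ gives the left eigenvector w L of
h P with the same eigenvalue. So L h Lᵀ is positive definite, and h is congruent to it. -/
theorem posDef_of_eigenvalues_pos {h P : Matrix ι ι ℝ} (hh : hᵀ = h) (hP : P.PosDef)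
    (hev : ∀ (lam : ℝ) (v : ι → ℝ), v ≠ 0 → v ᵥ* (h * P) = lam • v → 0 < lam) : h.PosDef := by
  obtain ⟨L, hL⟩ : ∃ L : Matrix ι ι ℝ, P = Lᴴ * L :=
    (CStarAlgebra.nonneg_iff_eq_star_mul_self (a := P)).mp
      (Matrix.nonneg_iff_posSemidef.mpr hP.posSemidef)
  rw [conjTranspose_eq_transpose_of_trivial] at hL
  have hdet : IsUnit L := by
    rw [Matrix.isUnit_iff_isUnit_det, isUnit_iff_ne_zero]
    intro h0
    have := hP.det_pos
    rw [hL, det_mul, h0, mul_zero] at this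
    exact lt_irrefl _ this
  have hA : (L * h * Lᵀ).IsHermitian := by
    rw [IsHermitian, conjTranspose_eq_transpose_of_trivial, transpose_mul, transpose_mul,
      transpose_transpose, hh, mul_assoc]
  have hpos : (L * h * Lᵀ).PosDef := by
    rw [hA.posDef_iff_eigenvalues_pos]
    intro i
    have h1 := hA.mulVec_eigenvectorBasis i
    have h2 : (hA.eigenvectorBasis i).ofLp ≠ 0 := by
      intro h0
      have := hA.eigenvectorBasis.orthonormal.ne_zero i
      exact this (by ext j; simpa using congrFun h0 j)
    generalize (hA.eigenvectorBasis i).ofLp = w at h1 h2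
    have h3 : w ᵥ* (L * h * Lᵀ) = hA.eigenvalues i • w := by
      rw [← h1, ← vecMul_transpose, ← conjTranspose_eq_transpose_of_trivial (_ * _), hA.eq]
    refine hev _ (w ᵥ* L) (fun h0 => h2 ?_) ?_
    · exact Matrix.vecMul_injective_of_isUnit hdet (by simpa using h0)
    · rw [← smul_vecMul, ← h3, hL]
      simp only [vecMul_vecMul, Matrix.mul_assoc]
  have := (Matrix.IsUnit.posDef_star_right_conjugate_iff (x := h) hdet).mp (by
    rwa [star_eq_conjTranspose, conjTranspose_eq_transpose_of_trivial])
  exact this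

/-- With P = LᵀL this is the trace of the positive semidefinite matrix L M Q Mᵀ Lᵀ. -/
theorem trace_mul_mul_mul_nonneg {P Q M : Matrix ι ι ℝ} (hP : P.PosSemidef)
    (hQ : Q.PosSemidef) (hM : Mᵀ = M) : 0 ≤ (P * (M * Q * M)).trace := by
  obtain ⟨L, hL⟩ : ∃ L : Matrix ι ι ℝ, P = Lᴴ * L :=
    (CStarAlgebra.nonneg_iff_eq_star_mul_self (a := P)).mp (Matrix.nonneg_iff_posSemidef.mpr hP)
  have h1 := ((hQ.mul_mul_conjTranspose_same M).mul_mul_conjTranspose_same L).trace_nonneg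
  rw [conjTranspose_eq_transpose_of_trivial M, hM, trace_mul_comm, ← mul_assoc, ← hL] at h1
  exact h1

/-- Cauchy–Schwarz for the form tr(P Y h⁻¹ Z) on symmetric matrices, with Y = h. -/
theorem trace_sq_le {P h Z : Matrix ι ι ℝ} (hP : P.PosSemidef) (hh : h.PosDef)
    (hZ : Zᵀ = Z) (hH : 0 < (h * P).trace) :
    (P * Z).trace ^ 2 / (h * P).trace ≤ (P * (Z * h⁻¹ * Z)).trace := by
  have hhT : hᵀ = h := by
    rw [← conjTranspose_eq_transpose_of_trivial]; exact hh.isHermitian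
  have hdet : IsUnit h.det := hh.det_pos.ne'.isUnit
  -- The minimiser of the nonnegative quadratic c ↦ tr(P (Z - c h) h⁻¹ (Z - c h)).
  set c := (P * Z).trace / (h * P).trace with hc
  have h1 := trace_mul_mul_mul_nonneg hP hh.inv.posSemidef (M := Z - c • h)
    (by rw [transpose_sub, transpose_smul, hZ, hhT])
  have h2 : (Z - c • h) * h⁻¹ * (Z - c • h) = Z * h⁻¹ * Z - (2 * c) • Z + c ^ 2 • h := by
    simp only [sub_mul, mul_sub, Matrix.smul_mul, Matrix.mul_smul, Matrix.mul_assoc,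
      Matrix.nonsing_inv_mul h hdet, Matrix.mul_one, Matrix.mul_nonsing_inv_cancel_left _ _ hdet]
    module
  rw [h2, mul_add, mul_sub, trace_add, trace_sub, Matrix.mul_smul, Matrix.mul_smul, trace_smul,
    trace_smul, trace_mul_comm P h, smul_eq_mul, smul_eq_mul] at h1
  have h3 : (P * Z).trace = c * (h * P).trace := by rw [hc]; field_simp
  rw [h3] at h1 ⊢
  have h4 : (c * (h * P).trace) ^ 2 / (h * P).trace = c ^ 2 * (h * P).trace := by field_simp
  rw [h4]
  linarith

/-- Evaluated at η, the sum is tr(P Z h⁻¹ Z), where Z has rows A_k η, and the rank-one term is (tr P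
Z)². Total symmetry of A makes Z symmetric, so `trace_sq_le` applies. -/
theorem cubic_form_posSemidef {P h : Matrix ι ι ℝ} (hP : P.PosSemidef) (hh : h.PosDef)
    (hH : 0 < (h * P).trace) {A : ι → Matrix ι ι ℝ} (hA : ∀ k, (A k)ᵀ = A k)
    (hA' : ∀ k i j, A k i j = A i k j) {u : ι → ℝ} (hu : ∀ k, u k = (A k * P).trace)
    {p q : ℝ} (hp : 0 ≤ p) (hq : -(2 * p / (h * P).trace) ≤ q) :
    ((2 * p) • ∑ k, ∑ l, P k l • (A l * h⁻¹ * A k) + q • vecMulVec u u).PosSemidef := by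
  have hPT : Pᵀ = P := by
    rw [← conjTranspose_eq_transpose_of_trivial]; exact hP.isHermitian
  have hhT : (h⁻¹)ᵀ = h⁻¹ := by
    rw [← conjTranspose_eq_transpose_of_trivial]; exact hh.inv.isHermitian
  have hs : ∀ k i j, A k i j = A k j i := fun k i j => by
    conv_lhs => rw [← hA, transpose_apply]
  refine PosSemidef.of_dotProduct_mulVec_nonneg ?_ fun η => ?_
  · rw [IsHermitian, conjTranspose_eq_transpose_of_trivial]
    simp only [transpose_add, transpose_smul, transpose_sum, transpose_mul, transpose_vecMulVec,
      hA, hhT, ← Matrix.mul_assoc]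
    congr 2
    rw [Finset.sum_comm]
    refine Finset.sum_congr rfl fun k _ => Finset.sum_congr rfl fun l _ => ?_
    conv_lhs => rw [← hPT, transpose_apply]
  · set Z : Matrix ι ι ℝ := Matrix.of fun k => A k *ᵥ η with hZdef
    have hZ : Zᵀ = Z := by
      ext i j
      simp only [hZdef, transpose_apply, of_apply, mulVec, dotProduct, hA' j i]
    have h1 : (P * (Z * h⁻¹ * Z)).trace
        = ∑ k, ∑ l, P k l * (η ⬝ᵥ ((A l * h⁻¹ * A k) *ᵥ η)) := by
      have h2 : ∀ l k, (Z * h⁻¹ * Z) l k = η ⬝ᵥ ((A l * h⁻¹ * A k) *ᵥ η) := by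
        intro l k
        have h3 : Z * h⁻¹ * Z = Z * h⁻¹ * Zᵀ := by rw [hZ]
        have h4 : (Z * h⁻¹ * Zᵀ) l k = (Z l ᵥ* h⁻¹) ⬝ᵥ Z k := rfl
        have h5 : Z l = η ᵥ* A l := by rw [← mulVec_transpose, hA]; rfl
        have h6 : Z k = A k *ᵥ η := rfl
        rw [h3, h4, h5, h6, dotProduct_mulVec, dotProduct_mulVec, vecMul_vecMul, vecMul_vecMul,
          Matrix.mul_assoc]
      rw [Matrix.trace]
      have h5 : ∀ k, (P * (Z * h⁻¹ * Z)) k k = ∑ l, P k l * (Z * h⁻¹ * Z) l k :=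
        fun k => Matrix.mul_apply
      simp only [diag_apply, h5, h2]
    have h2 : η ⬝ᵥ u = (P * Z).trace := by
      have h3 : ∀ i, (P * Z) i i = ∑ j, ∑ k, P i j * (A j i k * η k) := by
        intro i
        rw [Matrix.mul_apply]
        simp only [hZdef, of_apply, mulVec, dotProduct, Finset.mul_sum]
      have h4 : ∀ k, (A k * P).trace = ∑ i, ∑ j, A k i j * P j i := by
        intro k
        simp [Matrix.trace, Matrix.mul_apply]
      rw [Matrix.trace, dotProduct]
      simp only [diag_apply, h3, hu, h4, Finset.mul_sum]
      rw [Finset.sum_comm, Finset.sum_congr rfl fun i _ => Finset.sum_comm, Finset.sum_comm]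
      refine Finset.sum_congr rfl fun i _ => Finset.sum_congr rfl fun j _ =>
        Finset.sum_congr rfl fun k _ => ?_
      -- Total symmetry moves the index contracted with η into the derivative slot.
      rw [hs j i k, hA' j k i, hs k j i]
      ring
    have h3 := trace_sq_le hP hh hZ hH
    have h4 : star η ⬝ᵥ (((2 * p) • ∑ k, ∑ l, P k l • (A l * h⁻¹ * A k) + q • vecMulVec u u) *ᵥ η)
        = 2 * p * (P * (Z * h⁻¹ * Z)).trace + q * (P * Z).trace ^ 2 := by
      rw [h1, ← h2]
      simp only [star_trivial, add_mulVec, smul_mulVec, sum_mulVec, dotProduct_add,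
        dotProduct_smul, dotProduct_sum, vecMulVec_mulVec, smul_eq_mul]
      congr 2
      simp [dotProduct_comm u η, sq]
    rw [h4]
    have h5 : -(2 * p / (h * P).trace) * (P * Z).trace ^ 2 ≤ q * (P * Z).trace ^ 2 :=
      mul_le_mul_of_nonneg_right hq (sq_nonneg _)
    have h6 := mul_le_mul_of_nonneg_left h3 (by positivity : 0 ≤ 2 * p)
    have h7 : -(2 * p / (h * P).trace) * (P * Z).trace ^ 2
        = -(2 * p * ((P * Z).trace ^ 2 / (h * P).trace)) := by ring
    linarith

/-- The gradient terms in the evolution of the inverse Weingarten map have a sign. -/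
theorem gradient_terms_posSemidef {G P h B : Matrix ι ι ℝ} (hG : Gᵀ = G) (hP : P.PosSemidef)
    (hPG : P * G = 1) (hh : h.PosDef) (hB : B * (h * P) = 1) (hH : 0 < (h * P).trace)
    {C : ι → Matrix ι ι ℝ} (hC : ∀ k, (C k * G)ᵀ = C k * G) (hC' : ∀ k i j, C k i j = C i k j)
    {u : ι → ℝ} (hu : ∀ k, u k = (C k).trace) {p q : ℝ} (hp : 0 ≤ p)
    (hq : -(2 * p / (h * P).trace) ≤ q) :
    (((2 * p) • ∑ k, ∑ l, P k l • ((B * C l * B) * (h * P) * (B * C k * B))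
      + q • vecMulVec (B *ᵥ u) ((u ᵥ* P) ᵥ* B)) * G).PosSemidef := by
  have hGP : G * P = 1 := mul_eq_one_comm.mp hPG
  have hhT : hᵀ = h := by
    rw [← conjTranspose_eq_transpose_of_trivial]; exact hh.isHermitian
  have hPT : Pᵀ = P := by
    rw [← conjTranspose_eq_transpose_of_trivial]; exact hP.isHermitian
  have hdet : IsUnit h.det := hh.det_pos.ne'.isUnit
  have hBe : B = G * h⁻¹ := by
    have : (h * P) * (G * h⁻¹) = 1 := by
      rw [mul_assoc, ← mul_assoc P, hPG, one_mul, Matrix.mul_nonsing_inv _ hdet]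
    exact left_inv_eq_right_inv hB this
  -- Self-adjointness of B: lowering the upper index turns the right factor B into Bᵀ, so the whole
  -- expression becomes a congruence by B.
  have hBT : P * B * G = Bᵀ := by
    rw [hBe, ← mul_assoc P, hPG, one_mul, transpose_mul, hG, transpose_nonsing_inv, hhT]
  have key := (cubic_form_posSemidef hP hh hH (A := fun k => C k * G) hC
    (fun k i j => by
      rw [mul_apply, mul_apply]; exact Finset.sum_congr rfl fun m _ => by rw [hC'])
    (u := u) (fun k => by rw [hu, mul_assoc, hGP, mul_one]) hp hq).mul_mul_conjTranspose_same B
  convert key using 1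
  rw [conjTranspose_eq_transpose_of_trivial, ← hBT]
  have h1 : ∀ k l, B * C l * B * (h * P) * (B * C k * B) * G
      = B * (C l * G * h⁻¹ * (C k * G)) * (P * B * G) := by
    intro k l
    calc _ = B * C l * (B * (h * P)) * B * C k * (B * G) := by noncomm_ring
      _ = B * C l * B * C k * (G * P) * (B * G) := by rw [hB, hGP]; noncomm_ring
      _ = B * C l * (G * h⁻¹) * C k * (G * P) * (B * G) := by rw [← hBe]
      _ = _ := by noncomm_ring
  have h2 : vecMulVec (B *ᵥ u) ((u ᵥ* P) ᵥ* B) * G = B * vecMulVec u u * (P * B * G) := by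
    rw [mul_vecMulVec, vecMulVec_mul, vecMulVec_mul, vecMul_vecMul, vecMul_vecMul,
      Matrix.mul_assoc]
  simp only [add_mul, mul_add, Matrix.smul_mul, Matrix.mul_smul, Finset.sum_mul, Finset.mul_sum,
    h1, h2]

end LinearAlgebra

/-! ### Smooth functions on a set as a ring with derivations. -/

section SmoothFun

variable {V : Type*} [NormedAddCommGroup V] [NormedSpace ℝ V] {S : Set V}

/-- The algebra of the smooth functions on a set. -/
def smoothFun (S : Set V) : Subalgebra ℝ (S → ℝ) where
  carrier := {f | ∃ F : V → ℝ, ContDiffOn ℝ ∞ F S ∧ ∀ s : S, f s = F s}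
  mul_mem' := by
    rintro f g ⟨F, hF, hf⟩ ⟨G, hG, hg⟩
    exact ⟨fun x => F x * G x, hF.mul hG, fun s => by simp [hf, hg]⟩
  add_mem' := by
    rintro f g ⟨F, hF, hf⟩ ⟨G, hG, hg⟩
    exact ⟨fun x => F x + G x, hF.add hG, fun s => by simp [hf, hg]⟩
  algebraMap_mem' r := ⟨fun _ => r, contDiffOn_const, fun _ => rfl⟩

namespace smoothFun

/-- Restriction of a smooth function. -/
def mk (F : V → ℝ) (hF : ContDiffOn ℝ ∞ F S) : smoothFun S := ⟨fun s => F s, F, hF, fun _ => rfl⟩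

/-- Extension of a smooth function by zero. -/
def extend (f : smoothFun S) : V → ℝ := Function.extend Subtype.val f.1 0

theorem extend_apply (f : smoothFun S) (s : S) : (extend f) s = f.1 s :=
  Subtype.val_injective.extend_apply _ _ _

theorem contDiffOn_extend (f : smoothFun S) : ContDiffOn ℝ ∞ (extend f) S := by
  obtain ⟨F, hF, hf⟩ := f.2
  exact hF.congr fun x hx => by rw [← hf ⟨x, hx⟩, ← extend_apply f ⟨x, hx⟩]

/-- Evaluation at a point. -/
def eval (s : S) : smoothFun S →+* ℝ := (Pi.evalRingHom (fun _ : S => ℝ) s).comp (smoothFun S).val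

theorem eval_apply (s : S) (f : smoothFun S) : eval s f = f.1 s := rfl

theorem ext_iff_eval {f g : smoothFun S} : f = g ↔ ∀ s, eval s f = eval s g :=
  ⟨fun h _ => by rw [h], fun h => Subtype.ext (funext h)⟩

/-- The pointwise reciprocal is again smooth; this makes det g and det W invertible in the ring. -/
theorem isUnit_of_ne_zero {f : smoothFun S} (h : ∀ s, eval s f ≠ 0) : IsUnit f := by
  have hF : ContDiffOn ℝ ∞ (fun x => ((extend f) x)⁻¹) S :=
    (contDiffOn_extend f).inv fun x hx => by rw [extend_apply f ⟨x, hx⟩]; exact h ⟨x, hx⟩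
  refine IsUnit.of_mul_eq_one (mk _ hF) (ext_iff_eval.mpr fun s => ?_)
  have : eval s (mk _ hF) = (eval s f)⁻¹ := by
    change ((extend f) s)⁻¹ = _
    rw [extend_apply f]; rfl
  rw [map_mul, this, mul_inv_cancel₀ (h s), map_one]

variable (hS : UniqueDiffOn ℝ S)

omit hS in
-- A derivative within S sees only values on S, so the zero extension may be replaced by any other
-- one.
theorem fderivWithin_extend {F : V → ℝ} {f : smoothFun S} (h : ∀ s : S, F s = eval s f) (s : S) :
    fderivWithin ℝ (extend f) S s = fderivWithin ℝ F S s :=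
  fderivWithin_congr (fun x hx => by rw [h ⟨x, hx⟩, extend_apply f ⟨x, hx⟩]; rfl)
    (by rw [h s, extend_apply]; rfl)

/-- The derivative of smooth functions in direction `v`. -/
def der (v : V) : Derivation ℝ (smoothFun S) (smoothFun S) :=
  Derivation.mk'
    { toFun := fun f => mk (fun x => fderivWithin ℝ (extend f) S x v)
        (((contDiffOn_extend f).fderivWithin hS (m := ∞) (by simp)).clm_apply contDiffOn_const)
      map_add' := fun f g => by
        refine ext_iff_eval.mpr fun s => ?_
        change fderivWithin ℝ (extend (f + g)) S s v
          = fderivWithin ℝ (extend f) S s v + fderivWithin ℝ (extend g) S s v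
        have hf := (contDiffOn_extend f).differentiableOn (by simp) s s.2
        have hg := (contDiffOn_extend g).differentiableOn (by simp) s s.2
        rw [fderivWithin_extend (F := extend f + extend g), fderivWithin_add (hS s s.2) hf hg]
        · rfl
        · intro s
          rw [Pi.add_apply, extend_apply, extend_apply]; rfl
      map_smul' := fun r f => by
        refine ext_iff_eval.mpr fun s => ?_
        change fderivWithin ℝ (extend (r • f)) S s v = r * fderivWithin ℝ (extend f) S s v
        have hf := (contDiffOn_extend f).differentiableOn (by simp) s s.2
        rw [fderivWithin_extend (F := r • extend f), fderivWithin_const_smul (hS s s.2) hf]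
        · rfl
        · intro s
          rw [Pi.smul_apply, extend_apply]; rfl }
    (fun f g => by
      refine ext_iff_eval.mpr fun s => ?_
      change fderivWithin ℝ (extend (f * g)) S s v
        = f.1 s * fderivWithin ℝ (extend g) S s v + g.1 s * fderivWithin ℝ (extend f) S s v
      have hf := (contDiffOn_extend f).differentiableOn (by simp) s s.2
      have hg := (contDiffOn_extend g).differentiableOn (by simp) s s.2
      rw [fderivWithin_extend (F := extend f * extend g), fderivWithin_mul (hS s s.2) hf hg,
        extend_apply, extend_apply]
      · rfl
      · intro s
        rw [Pi.mul_apply, extend_apply, extend_apply]; rfl)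

theorem eval_der (v : V) (f : smoothFun S) (s : S) :
    eval s (der hS v f) = fderivWithin ℝ (extend f) S s v := rfl

theorem eval_der_of_eq {F : V → ℝ} {f : smoothFun S} (h : ∀ s : S, F s = eval s f) (v : V)
    (s : S) : eval s (der hS v f) = fderivWithin ℝ F S s v := by
  rw [eval_der, fderivWithin_extend h]

/-- Second derivatives within S are symmetric at points of S in the closure of its interior, which
allows the boundary time t = 0. -/
theorem der_comm (hS' : S ⊆ closure (interior S)) (v w : V) (f : smoothFun S) :
    der hS v (der hS w f) = der hS w (der hS v f) := by
  refine ext_iff_eval.mpr fun s => ?_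
  have hd : DifferentiableWithinAt ℝ (fderivWithin ℝ (extend f) S) S s :=
    ((contDiffOn_extend f).fderivWithin hS (m := ∞) (by simp)).differentiableOn (by simp) s s.2
  have key : ∀ v w, eval s (der hS v (der hS w f))
      = fderivWithin ℝ (fderivWithin ℝ (extend f) S) S s v w := by
    intro v w
    rw [eval_der_of_eq hS (F := fun x => fderivWithin ℝ (extend f) S x w) (fun s => rfl),
      fderivWithin_clm_apply (hS s s.2) hd (differentiableWithinAt_const w)]
    simp
  rw [key, key]
  exact ((contDiffOn_extend f) s s.2).isSymmSndFDerivWithinAt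
    (by simpa using WithTop.coe_le_coe.mpr (le_top : (2 : ℕ∞) ≤ ⊤)) hS (hS' s.2) s.2 v w

/-- The chain rule. -/
theorem der_comp {φ φ' : ℝ → ℝ} {f g g' : smoothFun S} (hg : ∀ s, eval s g = φ (eval s f))
    (hg' : ∀ s, eval s g' = φ' (eval s f))
    (hφ : ∀ s, HasDerivAt φ (φ' (eval s f)) (eval s f)) (v : V) :
    der hS v g = g' * der hS v f := by
  refine ext_iff_eval.mpr fun s => ?_
  have hf := ((contDiffOn_extend f).differentiableOn (by simp) s s.2).hasFDerivWithinAt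
  have h1 : (extend f) s = eval s f := extend_apply f s
  have h2 := (h1 ▸ hφ s : HasDerivAt φ (φ' (eval s f)) ((extend f) s)).comp_hasFDerivWithinAt
    (s : V) hf
  rw [eval_der_of_eq hS (F := φ ∘ (extend f)) (fun s => by rw [Function.comp, extend_apply f, hg]; rfl),
    h2.fderivWithin (hS s s.2), map_mul, hg', eval_der]
  simp

section Product

variable {A B : Type*} [NormedAddCommGroup A] [NormedSpace ℝ A] [NormedAddCommGroup B]
  [NormedSpace ℝ B] {I : Set A} {Ω : Set B} (hIΩ : UniqueDiffOn ℝ (I ×ˢ Ω))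

/-- Since Ω is open, the spatial derivative within the product set is an ordinary derivative, the
one used by `pd`. -/
theorem hasFDerivAt_slice (hΩ : IsOpen Ω) (f : smoothFun (I ×ˢ Ω)) {t : A} (ht : t ∈ I) {u : B → ℝ}
    (hu : ∀ y (hy : y ∈ Ω), u y = eval (S := I ×ˢ Ω) ⟨(t, y), ht, hy⟩ f) {x : B} (hx : x ∈ Ω) :
    ∃ u' : B →L[ℝ] ℝ, HasFDerivAt u u' x ∧
      ∀ v, u' v = eval (S := I ×ˢ Ω) ⟨(t, x), ht, hx⟩ (der hIΩ (0, v) f) := by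
  have hf := ((contDiffOn_extend f).differentiableOn (by simp) (t, x) ⟨ht, hx⟩).hasFDerivWithinAt
  have h1 : HasFDerivWithinAt (fun y : B => (t, y)) (ContinuousLinearMap.inr ℝ A B) Ω x :=
    (hasFDerivAt_prodMk_right t x).hasFDerivWithinAt
  have h2 := (hf.comp x h1 fun y hy => ⟨ht, hy⟩).hasFDerivAt (hΩ.mem_nhds hx)
  refine ⟨_, h2.congr_of_eventuallyEq ?_, fun v => rfl⟩
  filter_upwards [hΩ.mem_nhds hx] with y hy
  rw [hu y hy, eval_apply, ← extend_apply]; rfl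

end Product

theorem hasDerivWithinAt_slice {B : Type*} [NormedAddCommGroup B]
    [NormedSpace ℝ B] {I : Set ℝ} {Ω : Set B} (hIΩ : UniqueDiffOn ℝ (I ×ˢ Ω))
    (f : smoothFun (I ×ˢ Ω)) {x : B} (hx : x ∈ Ω) {u : ℝ → ℝ}
    (hu : ∀ s (hs : s ∈ I), u s = eval (S := I ×ˢ Ω) ⟨(s, x), hs, hx⟩ f) {t : ℝ} (ht : t ∈ I) :
    HasDerivWithinAt u (eval (S := I ×ˢ Ω) ⟨(t, x), ht, hx⟩ (der hIΩ (1, 0) f)) I t := by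
  have hf := ((contDiffOn_extend f).differentiableOn (by simp) (t, x) ⟨ht, hx⟩).hasFDerivWithinAt
  have h1 : HasDerivWithinAt (fun s : ℝ => (s, x)) ((1 : ℝ), (0 : B)) I t :=
    ((hasDerivAt_id t).prodMk (hasDerivAt_const t x)).hasDerivWithinAt
  have h2 := hf.comp_hasDerivWithinAt t h1 fun s hs => (⟨hs, hx⟩ : (s, x) ∈ I ×ˢ Ω)
  refine h2.congr (fun s hs => ?_) ?_
  · rw [hu s hs, eval_apply, ← extend_apply]; rfl
  · rw [hu t ht, eval_apply, ← extend_apply]; rfl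

end smoothFun
end SmoothFun

/-! ### Evaluation: from ring identities to coordinate expressions at a fixed time. -/

section Slice

open smoothFun

theorem eval_pd {n : ℕ} {I : Set ℝ} {Ω : Set (E n)} (hIΩ : UniqueDiffOn ℝ (I ×ˢ Ω))
    (hΩ : IsOpen Ω) {t : ℝ} (ht : t ∈ I) {f : smoothFun (I ×ˢ Ω)} {u : E n → ℝ}
    (hu : ∀ y (hy : y ∈ Ω), u y = eval (S := I ×ˢ Ω) ⟨(t, y), ht, hy⟩ f) (i : Fin n) {y : E n}
    (hy : y ∈ Ω) : pd i u y
      = eval (S := I ×ˢ Ω) ⟨(t, y), ht, hy⟩ (der hIΩ (0, EuclideanSpace.single i 1) f) := by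
  obtain ⟨u', hu', hv⟩ := hasFDerivAt_slice hIΩ hΩ f ht hu hy
  rw [pd, hu'.fderiv, hv]

theorem pd_apply {n m : ℕ} {u : E n → E m} {y : E n} (hd : DifferentiableAt ℝ u y) (i : Fin n)
    (a : Fin m) : pd i u y a = pd i (fun y => u y a) y := by
  have := (EuclideanSpace.proj a : E m →L[ℝ] ℝ).hasFDerivAt.comp y hd.hasFDerivAt
  exact congrArg (fun L : E n →L[ℝ] ℝ => L (EuclideanSpace.single i 1)) this.fderiv.symm

theorem eval_pd_vec {n : ℕ} {I : Set ℝ} {Ω : Set (E n)} (hIΩ : UniqueDiffOn ℝ (I ×ˢ Ω))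
    (hΩ : IsOpen Ω) {t : ℝ} (ht : t ∈ I) {m : ℕ} {f : Fin m → smoothFun (I ×ˢ Ω)} {u : E n → E m}
    (hu : ∀ y (hy : y ∈ Ω) a, u y a = eval (S := I ×ˢ Ω) ⟨(t, y), ht, hy⟩ (f a))
    (i : Fin n) {y : E n} (hy : y ∈ Ω) (a : Fin m) : pd i u y a
      = eval (S := I ×ˢ Ω) ⟨(t, y), ht, hy⟩ (der hIΩ (0, EuclideanSpace.single i 1) (f a)) := by
  have hd : DifferentiableAt ℝ u y := by
    rw [differentiableAt_euclidean]
    intro a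
    obtain ⟨u', hu', -⟩ := hasFDerivAt_slice hIΩ hΩ (f a) ht (fun y hy => hu y hy a) hy
    exact hu'.differentiableAt
  rw [pd_apply hd, eval_pd hIΩ hΩ ht (fun y hy => hu y hy a) i hy]

/-- `Y` and `N` are the position and the normal of the hypersurface `F` at the time `t`. -/
structure IsSlice {n : ℕ} {I : Set ℝ} {Ω : Set (E n)} (hIΩ : UniqueDiffOn ℝ (I ×ˢ Ω))
    (F : Hypersurface (smoothFun (I ×ˢ Ω)) (Fin n) (Fin (n + 1))) (t : ℝ) (Y N : E n → E (n + 1)) :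
    Prop where
  isOpen : IsOpen Ω
  mem : t ∈ I
  d_eq : ∀ i, F.d i = der hIΩ (0, EuclideanSpace.single i 1)
  Y_eq : ∀ y (hy : y ∈ Ω) a, Y y a = eval (S := I ×ˢ Ω) ⟨(t, y), mem, hy⟩ (F.x a)
  N_eq : ∀ y (hy : y ∈ Ω) a, N y a = eval (S := I ×ˢ Ω) ⟨(t, y), mem, hy⟩ (F.ν a)

namespace IsSlice

variable {n : ℕ} {I : Set ℝ} {Ω : Set (E n)} {hIΩ : UniqueDiffOn ℝ (I ×ˢ Ω)}
  {F : Hypersurface (smoothFun (I ×ˢ Ω)) (Fin n) (Fin (n + 1))} {t : ℝ} {Y N : E n → E (n + 1)}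
  (h : IsSlice hIΩ F t Y N)

include h

/-- Evaluation at the time `t` and the point `y`. -/
def ev {y : E n} (hy : y ∈ Ω) : smoothFun (I ×ˢ Ω) →+* ℝ := eval ⟨(t, y), h.mem, hy⟩

theorem pd_eq {f : smoothFun (I ×ˢ Ω)} {u : E n → ℝ} (hu : ∀ y (hy : y ∈ Ω), u y = h.ev hy f)
    (i : Fin n) {y : E n} (hy : y ∈ Ω) : pd i u y = h.ev hy (F.d i f) := by
  rw [eval_pd hIΩ h.isOpen h.mem hu i hy, h.d_eq]
  rfl

theorem pd_vec_eq {m : ℕ} {f : Fin m → smoothFun (I ×ˢ Ω)} {u : E n → E m}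
    (hu : ∀ y (hy : y ∈ Ω) a, u y a = h.ev hy (f a))
    (i : Fin n) {y : E n} (hy : y ∈ Ω) (a : Fin m) : pd i u y a = h.ev hy (F.d i (f a)) := by
  rw [eval_pd_vec hIΩ h.isOpen h.mem hu i hy, h.d_eq]
  rfl

theorem metric_eq {y : E n} (hy : y ∈ Ω) : metric Y y = F.G.map (h.ev hy) := by
  ext i j
  simp only [metric, of_apply, PiLp.inner_apply, h.pd_vec_eq h.Y_eq _ hy, Hypersurface.G,
    map_apply, map_sum, map_mul]
  exact Finset.sum_congr rfl fun a _ => mul_comm _ _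

theorem secondFF_eq {y : E n} (hy : y ∈ Ω) : secondFF Y N y = F.h.map (h.ev hy) := by
  ext i j
  have h1 : ∀ a, pd i (pd j Y) y a = h.ev hy (F.d i (F.d j (F.x a))) :=
    h.pd_vec_eq (fun y hy a => h.pd_vec_eq h.Y_eq j hy a) i hy
  simp only [secondFF, of_apply, PiLp.inner_apply, h1, h.N_eq y hy, Hypersurface.h,
    map_apply, map_sum, map_mul, map_neg, neg_inj]
  exact Finset.sum_congr rfl fun a _ => mul_comm _ _

theorem inv_metric_eq {y : E n} (hy : y ∈ Ω) : (metric Y y)⁻¹ = F.Gi.map (h.ev hy) := by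
  refine Matrix.inv_eq_left_inv ?_
  rw [h.metric_eq hy, ← Matrix.map_mul, F.Gi_mul_G, Matrix.map_one _ (map_zero _) (map_one _)]

theorem weingarten_eq {y : E n} (hy : y ∈ Ω) : weingarten Y N y = F.W.map (h.ev hy) := by
  rw [weingarten, h.secondFF_eq hy, h.inv_metric_eq hy, ← Matrix.map_mul, Hypersurface.W]

theorem invWeingarten_eq {B : Matrix (Fin n) (Fin n) (smoothFun (I ×ˢ Ω))} (hB : B * F.W = 1)
    {y : E n} (hy : y ∈ Ω) : invWeingarten Y N y = B.map (h.ev hy) := by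
  refine Matrix.inv_eq_left_inv ?_
  rw [h.weingarten_eq hy, ← Matrix.map_mul, hB, Matrix.map_one _ (map_zero _) (map_one _)]

theorem meanCurv_eq {y : E n} (hy : y ∈ Ω) : meanCurv Y N y = h.ev hy F.H := by
  rw [meanCurv, h.weingarten_eq hy, Hypersurface.H, Matrix.trace, Matrix.trace, map_sum]
  rfl

theorem normSqA_eq {y : E n} (hy : y ∈ Ω) : normSqA Y N y = h.ev hy (F.W * F.W).trace := by
  rw [normSqA, h.weingarten_eq hy, ← Matrix.map_mul, Matrix.trace, Matrix.trace, map_sum]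
  rfl

theorem christoffel_eq {y : E n} (hy : y ∈ Ω) (k i j : Fin n) :
    christoffel Y k i j y = h.ev hy (F.Γ i j k) := by
  have h1 : ∀ i j k, pd k (fun y => metric Y y i j) y = h.ev hy (F.d k (F.G i j)) :=
    fun i j k => h.pd_eq (fun y hy => by rw [h.metric_eq hy, map_apply]) k hy
  have h2 : h.ev hy (algebraMap ℝ _ (1 / 2)) = 1 / 2 := rfl
  simp only [christoffel, h1, h.inv_metric_eq hy, Hypersurface.Γ, of_apply, map_mul, h2, map_sum,
    map_sub, map_add, map_apply]

theorem covDeriv_eq {S : E n → Matrix (Fin n) (Fin n) ℝ}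
    {S' : Matrix (Fin n) (Fin n) (smoothFun (I ×ˢ Ω))}
    (hS : ∀ y (hy : y ∈ Ω), S y = S'.map (h.ev hy)) {y : E n} (hy : y ∈ Ω) (k : Fin n) :
    covDeriv Y S k y = (F.D k S').map (h.ev hy) := by
  ext i j
  have h1 : pd k (fun y => S y i j) y = h.ev hy (F.d k (S' i j)) :=
    h.pd_eq (fun y hy => by rw [hS y hy, map_apply]) k hy
  simp only [covDeriv, of_apply, h1, h.christoffel_eq hy, hS y hy, Hypersurface.D, map_apply,
    Matrix.add_apply, Matrix.sub_apply, mul_apply, map_add, map_sub, map_sum, map_mul]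
  simp only [mul_comm]

theorem covDeriv₂_eq {S : E n → Matrix (Fin n) (Fin n) ℝ}
    {S' : Matrix (Fin n) (Fin n) (smoothFun (I ×ˢ Ω))}
    (hS : ∀ y (hy : y ∈ Ω), S y = S'.map (h.ev hy)) {y : E n} (hy : y ∈ Ω) (l k : Fin n) :
    covDeriv₂ Y S l k y = (F.D₂ l k S').map (h.ev hy) := by
  ext i j
  have h1 : pd l (fun y => covDeriv Y S k y i j) y = h.ev hy (F.d l (F.D k S' i j)) :=
    h.pd_eq (fun y hy => by rw [h.covDeriv_eq hS hy, map_apply]) l hy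
  simp only [covDeriv₂, of_apply, h1, h.christoffel_eq hy, h.covDeriv_eq hS hy, map_apply,
    F.D₂_apply, map_add, map_sub, map_sum, map_mul]
  simp only [mul_comm]

theorem phiLaplacian_eq (Φ : ℝ → ℝ) {S : E n → Matrix (Fin n) (Fin n) ℝ}
    {S' : Matrix (Fin n) (Fin n) (smoothFun (I ×ˢ Ω))}
    (hS : ∀ y (hy : y ∈ Ω), S y = S'.map (h.ev hy)) {y : E n} (hy : y ∈ Ω) :
    phiLaplacian Y N Φ S y = deriv Φ (h.ev hy F.H) • (F.lap S').map (h.ev hy) := by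
  ext i j
  simp only [phiLaplacian, of_apply, h.meanCurv_eq hy, h.inv_metric_eq hy, h.covDeriv₂_eq hS hy,
    Matrix.smul_apply, map_apply, Hypersurface.lap, Matrix.sum_apply, map_sum, smul_eq_mul,
    map_mul, Finset.mul_sum, mul_assoc]

theorem gradTermB_eq {B : Matrix (Fin n) (Fin n) (smoothFun (I ×ˢ Ω))} (hB : B * F.W = 1)
    {y : E n} (hy : y ∈ Ω) :
    gradTermB Y N y = (∑ k, ∑ l, F.Gi k l • (F.D l B * F.W * F.D k B)).map (h.ev hy) := by
  ext i j
  simp only [gradTermB, of_apply, h.inv_metric_eq hy, h.weingarten_eq hy,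
    h.covDeriv_eq (fun y hy => h.invWeingarten_eq hB hy) hy, map_apply, Matrix.sum_apply,
    Matrix.smul_apply, mul_apply, smul_eq_mul, map_sum, map_mul, Finset.mul_sum, Finset.sum_mul]
  refine Finset.sum_congr rfl fun k _ => Finset.sum_congr rfl fun l _ => ?_
  rw [Finset.sum_comm]
  refine Finset.sum_congr rfl fun q _ => Finset.sum_congr rfl fun p _ => by ring

theorem gradTermH_eq {B : Matrix (Fin n) (Fin n) (smoothFun (I ×ˢ Ω))} (hB : B * F.W = 1)
    {y : E n} (hy : y ∈ Ω) :
    gradTermH Y N y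
      = (vecMulVec (B *ᵥ fun i => F.d i F.H) (F.grad F.H ᵥ* B)).map (h.ev hy) := by
  have h1 : ∀ i, pd i (meanCurv Y N) y = h.ev hy (F.d i F.H) :=
    fun i => h.pd_eq (fun y hy => h.meanCurv_eq hy) i hy
  have h2 : ∀ q, gradH Y N q y = h.ev hy (F.grad F.H q) := by
    intro q
    simp only [gradH, h1, h.inv_metric_eq hy, Hypersurface.grad, vecMul, dotProduct, map_sum,
      map_mul, map_apply]
    exact Finset.sum_congr rfl fun l _ => by rw [F.Gi_symm, mul_comm]
  ext i j
  simp only [gradTermH, of_apply, h1, h2, h.invWeingarten_eq hB hy, map_apply, vecMulVec_apply,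
    mulVec, vecMul, dotProduct, map_mul, map_sum]

end IsSlice
end Slice

open smoothFun

theorem metric_posDef {n : ℕ} {Y : E n → E (n + 1)} {y : E n}
    (hinj : Function.Injective (fderiv ℝ Y y)) : (metric Y y).PosDef := by
  have h1 : LinearIndependent ℝ fun i : Fin n => pd i Y y := by
    have := (EuclideanSpace.basisFun (Fin n) ℝ).toBasis.linearIndependent.map'
      (fderiv ℝ Y y : E n →ₗ[ℝ] E (n + 1)) (LinearMap.ker_eq_bot.mpr hinj)
    have h2 : (fun i : Fin n => pd i Y y)
        = (fderiv ℝ Y y : E n →ₗ[ℝ] E (n + 1)) ∘ (EuclideanSpace.basisFun (Fin n) ℝ).toBasis := by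
      ext1 i; simp [pd]
    rw [h2]
    exact this
  exact Matrix.posDef_gram_of_linearIndependent h1

/-! ### The theorem in a coordinate domain. -/

section LocalFlow

variable {n : ℕ} {I : Set ℝ} {Ω : Set (E n)} {X N : ℝ → E n → E (n + 1)}

/-- One hypersurface over the ring of space-time functions serves all times. Time is not among its
coordinates; it enters later as the additional derivation τ. -/
theorem exists_isSlice (hIΩ : UniqueDiffOn ℝ (I ×ˢ Ω))
    (hcl : I ×ˢ Ω ⊆ closure (interior (I ×ˢ Ω))) (hΩ : IsOpen Ω)
    (hX : ContDiffOn ℝ ∞ (fun q : ℝ × E n => X q.1 q.2) (I ×ˢ Ω))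
    (hN : ContDiffOn ℝ ∞ (fun q : ℝ × E n => N q.1 q.2) (I ×ˢ Ω))
    (hinj : ∀ t ∈ I, ∀ y ∈ Ω, Function.Injective (fderiv ℝ (X t) y))
    (hunit : ∀ t ∈ I, ∀ y ∈ Ω, ‖N t y‖ = 1)
    (hnormal : ∀ t ∈ I, ∀ y ∈ Ω, ∀ v, inner ℝ (fderiv ℝ (X t) y v) (N t y) = 0) :
    ∃ F : Hypersurface (smoothFun (I ×ˢ Ω)) (Fin n) (Fin (n + 1)),
      ∀ t ∈ I, IsSlice hIΩ F t (X t) (N t) := by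
  let x : Fin (n + 1) → smoothFun (I ×ˢ Ω) := fun a => mk _ (contDiffOn_euclidean.mp hX a)
  let ν : Fin (n + 1) → smoothFun (I ×ˢ Ω) := fun a => mk _ (contDiffOn_euclidean.mp hN a)
  have hx : ∀ t (ht : t ∈ I) y (hy : y ∈ Ω) a,
      X t y a = eval (S := I ×ˢ Ω) ⟨(t, y), ht, hy⟩ (x a) := fun t ht y hy a => rfl
  have hν : ∀ t (ht : t ∈ I) y (hy : y ∈ Ω) a,
      N t y a = eval (S := I ×ˢ Ω) ⟨(t, y), ht, hy⟩ (ν a) := fun t ht y hy a => rfl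
  have hpd : ∀ t (ht : t ∈ I) y (hy : y ∈ Ω) i a, pd i (X t) y a = eval (S := I ×ˢ Ω)
      ⟨(t, y), ht, hy⟩ (der hIΩ (0, EuclideanSpace.single i 1) (x a)) :=
    fun t ht y hy i a => eval_pd_vec hIΩ hΩ ht (hx t ht) i hy a
  refine ⟨{ d := fun i => der hIΩ (0, EuclideanSpace.single i 1)
            d_comm := fun i j f => der_comm hIΩ hcl _ _ f
            x := x
            ν := ν
            normal := fun i => ext_iff_eval.mpr ?_
            unit := ext_iff_eval.mpr ?_
            isUnit_metric := isUnit_of_ne_zero ?_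
            codim_one := ⟨Fintype.equivOfCardEq (by simp)⟩ },
    fun t ht => ⟨hΩ, ht, fun i => rfl, hx t ht, hν t ht⟩⟩
  · rintro ⟨⟨t, y⟩, ht, hy⟩
    rw [map_sum, map_zero]
    refine Eq.trans (Finset.sum_congr rfl fun a _ => ?_)
      ((PiLp.inner_apply _ _).symm.trans (hnormal t ht y hy (EuclideanSpace.single i 1)))
    exact (map_mul _ _ _).trans ((congrArg₂ (· * ·) (hpd t ht y hy i a)
      (hν t ht y hy a)).symm.trans (mul_comm _ _))
  · rintro ⟨⟨t, y⟩, ht, hy⟩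
    rw [map_sum, map_one]
    refine Eq.trans (Finset.sum_congr rfl fun a _ => ?_)
      ((EuclideanSpace.real_norm_sq_eq _).symm.trans (by rw [hunit t ht y hy, one_pow]))
    exact (map_mul _ _ _).trans (sq _).symm
  · rintro ⟨⟨t, y⟩, ht, hy⟩
    rw [RingHom.map_det]
    refine fun h0 => (metric_posDef (hinj t ht y hy)).det_pos.ne'
      (Eq.trans (congrArg Matrix.det ?_) h0)
    ext i j
    simp only [RingHom.mapMatrix_apply, map_apply, of_apply, map_sum, map_mul, metric,
      PiLp.inner_apply, hpd t ht y hy]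
    exact Finset.sum_congr rfl fun a _ => mul_comm _ _

variable {Φ : ℝ → ℝ} {U : Set ℝ}

theorem local_evolution (hI : UniqueDiffOn ℝ I) (hIΩ : UniqueDiffOn ℝ (I ×ˢ Ω))
    (hcl : I ×ˢ Ω ⊆ closure (interior (I ×ˢ Ω))) (hΩ : IsOpen Ω)
    (hX : ContDiffOn ℝ ∞ (fun q : ℝ × E n => X q.1 q.2) (I ×ˢ Ω))
    (hN : ContDiffOn ℝ ∞ (fun q : ℝ × E n => N q.1 q.2) (I ×ˢ Ω))
    (hinj : ∀ t ∈ I, ∀ y ∈ Ω, Function.Injective (fderiv ℝ (X t) y))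
    (hunit : ∀ t ∈ I, ∀ y ∈ Ω, ‖N t y‖ = 1)
    (hnormal : ∀ t ∈ I, ∀ y ∈ Ω, ∀ v, inner ℝ (fderiv ℝ (X t) y v) (N t y) = 0)
    (hUo : IsOpen U) (hU : U ⊆ Ioi 0) (hΦ : ContDiffOn ℝ ∞ Φ U) (hΦ' : ∀ x ∈ U, 0 < deriv Φ x)
    (hΦ'' : ∀ x ∈ U, -(2 * deriv Φ x / x) ≤ deriv (deriv Φ) x)
    (hHU : ∀ t ∈ I, ∀ y ∈ Ω, meanCurv (X t) (N t) y ∈ U)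
    (hflow : ∀ t ∈ I, ∀ y ∈ Ω, HasDerivWithinAt (fun s => X s y)
      (-(Φ (meanCurv (X t) (N t) y) • N t y)) I t)
    (hconv : ∀ t ∈ I, ∀ y ∈ Ω, ∀ lam, IsPrincipalCurvature (X t) (N t) y lam → 0 < lam)
    {t : ℝ} (ht : t ∈ I) {y : E n} (hy : y ∈ Ω) :
    (invWeingarten (X t) (N t) y * weingarten (X t) (N t) y = 1 ∧
      weingarten (X t) (N t) y * invWeingarten (X t) (N t) y = 1) ∧
    (∀ i j, HasDerivWithinAt (fun s => invWeingarten (X s) (N s) y i j)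
      ((reactionDiffusion (X t) (N t) Φ y
        - (2 * deriv Φ (meanCurv (X t) (N t) y)) • gradTermB (X t) (N t) y
        - (deriv (deriv Φ) (meanCurv (X t) (N t) y)) • gradTermH (X t) (N t) y) i j) I t) ∧
    ((reactionDiffusion (X t) (N t) Φ y
        - Matrix.of (fun i j => derivWithin (fun s => invWeingarten (X s) (N s) y i j) I t))
      * metric (X t) y).PosSemidef := by
  obtain ⟨F, hF⟩ := exists_isSlice hIΩ hcl hΩ hX hN hinj hunit hnormal
  -- Strict convexity excludes the eigenvalue 0 at every point, so W is invertible in the ring and b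
  -- is smooth in space-time.
  have hdetW : IsUnit F.W.det := by
    refine isUnit_of_ne_zero ?_
    rintro ⟨⟨s, z⟩, hs, hz⟩ h0
    rw [RingHom.map_det] at h0
    have h1 : (weingarten (X s) (N s) z).det = 0 := by
      rw [(hF s hs).weingarten_eq hz]; exact h0
    obtain ⟨v, hv, hv'⟩ := Matrix.exists_vecMul_eq_zero_iff.mpr h1
    exact lt_irrefl _ (hconv s hs z hz 0 ⟨v, hv, by rw [hv', zero_smul]⟩)
  set B := F.W⁻¹
  have hB : B * F.W = 1 := Matrix.nonsing_inv_mul _ hdetW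
  have hB' : F.W * B = 1 := Matrix.mul_nonsing_inv _ hdetW
  have hHmem : ∀ s : (I ×ˢ Ω : Set (ℝ × E n)), eval s F.H ∈ U := by
    rintro ⟨⟨s, z⟩, hs, hz⟩
    have := hHU s hs z hz
    rwa [(hF s hs).meanCurv_eq hz] at this
  have hcomp : ∀ {ψ : ℝ → ℝ}, ContDiffOn ℝ ∞ ψ U →
      ContDiffOn ℝ ∞ (fun q => ψ (extend F.H q)) (I ×ˢ Ω) := fun hψ =>
    hψ.comp (contDiffOn_extend F.H) fun q hq => by
      rw [extend_apply F.H ⟨q, hq⟩]; exact hHmem ⟨q, hq⟩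
  have hev : ∀ {ψ : ℝ → ℝ} (hψ : ContDiffOn ℝ ∞ ψ U) (s : (I ×ˢ Ω : Set (ℝ × E n))),
      eval s (mk _ (hcomp hψ)) = ψ (eval s F.H) := fun {ψ} _ s =>
    congrArg ψ (extend_apply F.H s)
  have hd : ContDiffOn ℝ ∞ (deriv Φ) U := hΦ.deriv_of_isOpen hUo (by simp)
  have hdd : ContDiffOn ℝ ∞ (deriv (deriv Φ)) U := hd.deriv_of_isOpen hUo (by simp)
  have hder : ∀ {ψ : ℝ → ℝ}, ContDiffOn ℝ ∞ ψ U → ∀ s : (I ×ˢ Ω : Set (ℝ × E n)),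
      HasDerivAt ψ (deriv ψ (eval s F.H)) (eval s F.H) := fun hψ s =>
    ((hψ.contDiffAt (hUo.mem_nhds (hHmem s))).differentiableAt (by simp)).hasDerivAt
  set φ := mk _ (hcomp hΦ)
  set φ' := mk _ (hcomp hd)
  set φ'' := mk _ (hcomp hdd)
  have hx : ∀ a, der hIΩ (1, 0) (F.x a) = -(φ * F.ν a) := by
    intro a
    refine ext_iff_eval.mpr ?_
    rintro ⟨⟨s, z⟩, hs, hz⟩
    have h1 := hasDerivWithinAt_slice hIΩ (F.x a) hz (fun r hr => (hF r hr).Y_eq z hz a) hs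
    have h2 := (EuclideanSpace.proj a : E (n + 1) →L[ℝ] ℝ).hasFDerivAt.comp_hasDerivWithinAt s
      (hflow s hs z hz)
    -- Derivatives within I are unique, so the ring derivation in time agrees with the one-sided
    -- derivative given by the flow.
    refine ((hI s hs).eq_deriv _ h1 h2).trans ?_
    change -(Φ (meanCurv (X s) (N s) z) * N s z a) = -(eval _ φ * eval _ (F.ν a))
    rw [(hF s hs).meanCurv_eq hz, (hF s hs).N_eq z hz a, hev hΦ]
    rfl
  have hdφ : ∀ i, F.d i φ = φ' * F.d i F.H := fun i => by
    rw [(hF t ht).d_eq]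
    exact der_comp hIΩ (hev hΦ) (hev hd) (hder hΦ) _
  have hdφ' : ∀ i, F.d i φ' = φ'' * F.d i F.H := fun i => by
    rw [(hF t ht).d_eq]
    exact der_comp hIΩ (hev hd) (hev hdd) (hder hd) _
  have hτ : ∀ i f, der hIΩ (1, 0) (F.d i f) = F.d i (der hIΩ (1, 0) f) := fun i f => by
    rw [(hF t ht).d_eq]; exact der_comm hIΩ hcl _ _ f
  have hevol := F.evolution_inv hB hB' hτ hx hdφ hdφ'
  have hS := hF t ht
  have hφe : hS.ev hy φ = Φ (meanCurv (X t) (N t) y) := by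
    rw [hS.meanCurv_eq hy]; exact hev hΦ _
  have hφe' : hS.ev hy φ' = deriv Φ (meanCurv (X t) (N t) y) := by
    rw [hS.meanCurv_eq hy]; exact hev hd _
  have hφe'' : hS.ev hy φ'' = deriv (deriv Φ) (meanCurv (X t) (N t) y) := by
    rw [hS.meanCurv_eq hy]; exact hev hdd _
  have hderiv : ∀ i j, HasDerivWithinAt (fun s => invWeingarten (X s) (N s) y i j)
      ((reactionDiffusion (X t) (N t) Φ y
        - (2 * deriv Φ (meanCurv (X t) (N t) y)) • gradTermB (X t) (N t) y
        - (deriv (deriv Φ) (meanCurv (X t) (N t) y)) • gradTermH (X t) (N t) y) i j) I t := by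
    intro i j
    have h1 := hasDerivWithinAt_slice hIΩ (B i j) hy
      (u := fun s => invWeingarten (X s) (N s) y i j)
      (fun s hs => by rw [(hF s hs).invWeingarten_eq hB hy]; rfl) ht
    convert h1 using 1
    have h2 := congrArg (hS.ev hy) (congrFun (congrFun hevol i) j)
    have h3 : hS.ev hy (B.map (der hIΩ (1, 0)) i j)
      = eval (S := I ×ˢ Ω) ⟨(t, y), ht, hy⟩ (der hIΩ (1, 0) (B i j)) := rfl
    have h4 : hS.ev hy ((1 : Matrix (Fin n) (Fin n) (smoothFun (I ×ˢ Ω))) i j)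
        = (1 : Matrix (Fin n) (Fin n) ℝ) i j := by
      simp only [Matrix.one_apply]; split_ifs <;> simp
    rw [← h3, h2]
    simp only [reactionDiffusion, hS.phiLaplacian_eq Φ (fun y hy => hS.invWeingarten_eq hB hy) hy,
      hS.gradTermB_eq hB hy, hS.gradTermH_eq hB hy, hS.normSqA_eq hy, hS.invWeingarten_eq hB hy,
      Matrix.sub_apply, Matrix.add_apply, Matrix.smul_apply, smul_eq_mul, map_sub, map_add,
      map_mul, map_apply, hφe, hφe', hφe'', hS.meanCurv_eq hy, h4, map_ofNat]
  refine ⟨⟨?_, ?_⟩, hderiv, ?_⟩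
  · rw [hS.invWeingarten_eq hB hy, hS.weingarten_eq hy, ← Matrix.map_mul, hB,
      Matrix.map_one _ (map_zero _) (map_one _)]
  · rw [hS.invWeingarten_eq hB hy, hS.weingarten_eq hy, ← Matrix.map_mul, hB',
      Matrix.map_one _ (map_zero _) (map_one _)]
  -- By the evolution equation the difference consists of the two gradient terms alone.
  have h1 : reactionDiffusion (X t) (N t) Φ y
        - Matrix.of (fun i j => derivWithin (fun s => invWeingarten (X s) (N s) y i j) I t)
      = (2 * deriv Φ (meanCurv (X t) (N t) y)) • gradTermB (X t) (N t) y
        + (deriv (deriv Φ) (meanCurv (X t) (N t) y)) • gradTermH (X t) (N t) y := by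
    ext i j
    rw [Matrix.sub_apply, of_apply, (hderiv i j).derivWithin (hI t ht)]
    simp only [Matrix.sub_apply, Matrix.add_apply]
    ring
  have hmul : ∀ A A' : Matrix (Fin n) (Fin n) (smoothFun (I ×ˢ Ω)),
      A.map (hS.ev hy) * A'.map (hS.ev hy) = (A * A').map (hS.ev hy) :=
    fun A A' => Matrix.map_mul.symm
  have hG := metric_posDef (hinj t ht y hy)
  have hP : (F.Gi.map (hS.ev hy)).PosDef := by
    rw [← hS.inv_metric_eq hy]; exact hG.inv
  have hh : (F.h.map (hS.ev hy)).PosDef := by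
    refine posDef_of_eigenvalues_pos (by rw [← transpose_map, F.h_transpose]) hP ?_
    intro lam v hv hlam
    refine hconv t ht y hy lam ⟨v, hv, ?_⟩
    rw [hS.weingarten_eq hy, ← hlam, hmul]
    rfl
  have hHe : (F.h.map (hS.ev hy) * F.Gi.map (hS.ev hy)).trace = meanCurv (X t) (N t) y := by
    rw [meanCurv, hS.weingarten_eq hy, hmul]; rfl
  have hD : ∀ l, F.D l B = -(B * F.D l F.W * B) := fun l => F.D_inv hB hB' l
  have key := gradient_terms_posSemidef (G := F.G.map (hS.ev hy)) (P := F.Gi.map (hS.ev hy))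
    (h := F.h.map (hS.ev hy)) (B := B.map (hS.ev hy)) (C := fun k => (F.D k F.W).map (hS.ev hy))
    (u := fun k => hS.ev hy (F.d k F.H)) (p := deriv Φ (meanCurv (X t) (N t) y))
    (q := deriv (deriv Φ) (meanCurv (X t) (N t) y))
    (by rw [← transpose_map, F.G_transpose]) hP.posSemidef
    (by rw [hmul, F.Gi_mul_G, Matrix.map_one _ (map_zero _) (map_one _)]) hh
    (by rw [hmul, hmul, ← Hypersurface.W, hB, Matrix.map_one _ (map_zero _) (map_one _)])
    (by rw [hHe]; exact hU (hHU t ht y hy))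
    (fun k => by
      have h2 : F.D k F.W * F.G = F.G * (F.Gi * F.D k F.W) * F.G := by
        rw [← mul_assoc F.G, F.G_mul_Gi, one_mul]
      rw [hmul, ← transpose_map, h2, transpose_mul, transpose_mul, F.Gi_mul_D_W_transpose,
        F.G_transpose, mul_assoc F.G (F.Gi * F.D k F.W)])
    (fun k i j => congrArg (hS.ev hy) (F.codazzi k i j))
    (fun k => by
      rw [Hypersurface.H, ← F.D_trace, Matrix.trace, Matrix.trace, map_sum]; rfl)
    (hΦ' _ (hHU t ht y hy)).le (by rw [hHe]; exact hΦ'' _ (hHU t ht y hy))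
  rw [h1, hS.metric_eq hy]
  -- The minus sign in ∇b = -b (∇W) b occurs twice in the first gradient term and cancels.
  convert key using 3
  · congr 1
    rw [hS.gradTermB_eq hB hy]
    have hW : F.h * F.Gi = F.W := rfl
    simp only [hmul, hW, hD, Matrix.neg_mul, Matrix.mul_neg, neg_neg]
    ext i j
    simp only [map_apply, Matrix.sum_apply, Matrix.smul_apply, map_sum, smul_eq_mul, map_mul]
  · congr 1
    rw [hS.gradTermH_eq hB hy]
    ext i j
    simp only [map_apply, vecMulVec_apply, mulVec, vecMul, dotProduct, map_mul, map_sum,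
      Hypersurface.grad]

end LocalFlow

/-! ### Passage from the manifold to a chart. -/

section Charts

variable {n : ℕ} {M : Type*} [TopologicalSpace M] [ChartedSpace (E n) M]

theorem contDiffOn_inChart [IsManifold (𝓡 n) ∞ M] {e : OpenPartialHomeomorph M (E n)}
    (he : IsSmoothChart e) {I : Set ℝ} {m : ℕ} {f : ℝ → M → E m}
    (hf : ContMDiffOn (𝓘(ℝ, ℝ).prod (𝓡 n)) 𝓘(ℝ, E m) ∞ (fun q : ℝ × M => f q.1 q.2)
      (I ×ˢ univ)) :
    ContDiffOn ℝ ∞ (fun q : ℝ × E n => inChart e (f q.1) q.2) (I ×ˢ e.target) := by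
  rw [← contMDiffOn_iff_contDiffOn]
  have h1 : ContMDiffOn 𝓘(ℝ, ℝ × E n) (𝓡 n) ∞ (fun q : ℝ × E n => e.symm q.2)
      (I ×ˢ e.target) :=
    (contMDiffOn_symm_of_mem_maximalAtlas he).comp
      (contDiff_snd.contMDiff.contMDiffOn) fun q hq => hq.2
  have h2 : ContMDiffOn 𝓘(ℝ, ℝ × E n) 𝓘(ℝ, ℝ) ∞ (fun q : ℝ × E n => q.1) (I ×ˢ e.target) :=
    contDiff_fst.contMDiff.contMDiffOn
  exact hf.comp (h2.prodMk h1) fun q hq => ⟨hq.1, mem_univ _⟩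

/-- The chain rule for f ∘ e⁻¹, and for e ∘ e⁻¹ = id near y, which makes the differential of e⁻¹
injective. Together they carry the immersion and normality conditions to the chart. -/
theorem fderiv_inChart [IsManifold (𝓡 n) ∞ M] {e : OpenPartialHomeomorph M (E n)}
    (he : IsSmoothChart e) {m : ℕ} {f : M → E m}
    (hf : MDifferentiable (𝓡 n) 𝓘(ℝ, E m) f) {y : E n} (hy : y ∈ e.target) :
    (∀ v, fderiv ℝ (inChart e f) y v
      = mfderiv (𝓡 n) 𝓘(ℝ, E m) f (e.symm y) (mfderiv (𝓡 n) (𝓡 n) e.symm y v)) ∧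
    Function.Injective (mfderiv (𝓡 n) (𝓡 n) e.symm y) := by
  have h1 : MDifferentiableAt (𝓡 n) (𝓡 n) e.symm y :=
    ((contMDiffOn_symm_of_mem_maximalAtlas he).contMDiffAt
      (e.open_target.mem_nhds hy)).mdifferentiableAt (by simp)
  have h2 : MDifferentiableAt (𝓡 n) (𝓡 n) e (e.symm y) :=
    ((contMDiffOn_of_mem_maximalAtlas he).contMDiffAt
      (e.open_source.mem_nhds (e.map_target hy))).mdifferentiableAt (by simp)
  constructor
  · intro v
    have h3 := mfderiv_comp y (hf (e.symm y)) h1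
    rw [mfderiv_eq_fderiv] at h3
    exact congrArg (fun L : E n →L[ℝ] E m => L v) h3
  · have h3 := mfderiv_comp y h2 h1
    have h4 : mfderiv (𝓡 n) (𝓡 n) (e ∘ e.symm) y = mfderiv (𝓡 n) (𝓡 n) id y := by
      refine Filter.EventuallyEq.mfderiv_eq ?_
      filter_upwards [e.open_target.mem_nhds hy] with z hz
      exact e.right_inv hz
    rw [h4, mfderiv_id] at h3
    intro v w hvw
    have h5 : ∀ v, v = mfderiv (𝓡 n) (𝓡 n) e (e.symm y) (mfderiv (𝓡 n) (𝓡 n) e.symm y v) :=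
      fun v => congrArg (fun L : E n →L[ℝ] E n => L v) h3
    rw [h5 v, h5 w, hvw]

theorem mdifferentiable_slice {I : Set ℝ} {m : ℕ} {f : ℝ → M → E m}
    (hf : ContMDiffOn (𝓘(ℝ, ℝ).prod (𝓡 n)) 𝓘(ℝ, E m) ∞ (fun q : ℝ × M => f q.1 q.2)
      (I ×ˢ univ)) {t : ℝ} (ht : t ∈ I) : MDifferentiable (𝓡 n) 𝓘(ℝ, E m) (f t) := by
  have h1 : ContMDiffOn (𝓡 n) (𝓘(ℝ, ℝ).prod (𝓡 n)) ∞ (fun p : M => (t, p)) univ :=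
    (contMDiff_const.prodMk contMDiff_id).contMDiffOn
  have h2 := hf.comp h1 fun p _ => ⟨ht, mem_univ _⟩
  exact (contMDiffOn_univ.mp h2).mdifferentiable (by simp)

end Charts

theorem Ico_prod_subset_closure_interior {V : Type*} [TopologicalSpace V] {T : ℝ} {Ω : Set V}
    (hΩ : IsOpen Ω) : Ico 0 T ×ˢ Ω ⊆ closure (interior (Ico 0 T ×ˢ Ω)) := by
  rintro ⟨t, y⟩ ⟨ht, hy⟩
  -- Membership of t in [0, T) forces 0 < T, so the closure of the open interval contains 0.
  have hT : (0 : ℝ) ≠ T := (ht.1.trans_lt ht.2).ne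
  rw [interior_prod_eq, closure_prod_eq, interior_Ico, closure_Ioo hT, hΩ.interior_eq]
  exact ⟨⟨ht.1, ht.2.le⟩, subset_closure hy⟩

end PhiFlow

end

theorem mainTheorem10 {n : ℕ} (hn : 2 ≤ n)
    {M : Type*} [TopologicalSpace M] [ChartedSpace (PhiFlow.E n) M]
    [IsManifold (𝓡 n) ∞ M] [CompactSpace M] [T2Space M]
    (Φ : ℝ → ℝ) (U : Set ℝ) (hUo : IsOpen U) (hU : U ⊆ Ioi 0)
    (hΦ : ContDiffOn ℝ ∞ Φ U)
    (hΦ' : ∀ x ∈ U, 0 < deriv Φ x)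
    (hΦ'' : ∀ x ∈ U, -(2 * deriv Φ x / x) ≤ deriv (deriv Φ) x)
    (T : ℝ) (X ν : ℝ → M → PhiFlow.E (n + 1))
    (hX : PhiFlow.IsPhiFlow Φ U T X ν)
    (hconv : ∀ t ∈ Ico 0 T, PhiFlow.IsStrictlyConvex (X t) (ν t))
    (e : OpenPartialHomeomorph M (PhiFlow.E n)) (he : PhiFlow.IsSmoothChart e)
    (p : M) (hp : p ∈ e.source) (t : ℝ) (ht : t ∈ Ico 0 T) :
    let Y : ℝ → PhiFlow.E n → PhiFlow.E (n + 1) := fun s => PhiFlow.inChart e (X s)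
    let N : ℝ → PhiFlow.E n → PhiFlow.E (n + 1) := fun s => PhiFlow.inChart e (ν s)
    let b : ℝ → Matrix (Fin n) (Fin n) ℝ := fun s => PhiFlow.invWeingarten (Y s) (N s) (e p)
    let H : ℝ := PhiFlow.meanCurv (Y t) (N t) (e p)
    -- `b` is the two-sided inverse of the Weingarten map
    (b t * PhiFlow.weingarten (Y t) (N t) (e p) = 1 ∧
      PhiFlow.weingarten (Y t) (N t) (e p) * b t = 1) ∧
    -- the evolution equation
    (∀ i j, HasDerivWithinAt (fun s => b s i j)
      ((PhiFlow.reactionDiffusion (Y t) (N t) Φ (e p)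
        - (2 * deriv Φ H) • PhiFlow.gradTermB (Y t) (N t) (e p)
        - (deriv (deriv Φ) H) • PhiFlow.gradTermH (Y t) (N t) (e p)) i j) (Ico 0 T) t) ∧
    -- the inequality `∂_t b ≤ Δ_Φ b + (Φ' H - Φ) δ - Φ' |A|² b` between self-adjoint maps:
    -- right side minus left side, with its upper index lowered, is symmetric and nonnegative
    ((PhiFlow.reactionDiffusion (Y t) (N t) Φ (e p)
        - Matrix.of (fun i j => derivWithin (fun s => b s i j) (Ico 0 T) t))
      * PhiFlow.metric (Y t) (e p)).PosSemidef := by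
  have h1 : ∀ s ∈ Ico 0 T, ∀ y ∈ e.target, ∀ v, _ :=
    fun s hs y hy => (PhiFlow.fderiv_inChart he
      (PhiFlow.mdifferentiable_slice hX.smooth hs) hy).1
  have h2 : ∀ y ∈ e.target, ∀ s ∈ Ico 0 T, _ :=
    fun y hy s hs => (PhiFlow.fderiv_inChart he
      (PhiFlow.mdifferentiable_slice hX.smooth hs) hy).2
  refine PhiFlow.local_evolution (uniqueDiffOn_Ico 0 T)
    ((uniqueDiffOn_Ico 0 T).prod e.open_target.uniqueDiffOn)
    (PhiFlow.Ico_prod_subset_closure_interior e.open_target) e.open_target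
    (X := fun s => PhiFlow.inChart e (X s)) (N := fun s => PhiFlow.inChart e (ν s))
    (PhiFlow.contDiffOn_inChart he hX.smooth) (PhiFlow.contDiffOn_inChart he hX.smooth_normal)
    (fun s hs y hy v w hvw => ?_) (fun s hs y hy => hX.unit_normal s hs _)
    (fun s hs y hy v => ?_) hUo hU hΦ hΦ' hΦ'' (fun s hs y hy => ?_) (fun s hs y hy => ?_)
    (fun s hs y hy lam hlam => ?_) ht (e.map_source hp)
  · rw [h1 s hs y hy, h1 s hs y hy] at hvw
    exact h2 y hy s hs (hX.immersion s hs _ hvw)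
  · rw [h1 s hs y hy]
    exact hX.normal s hs _ _
  · have := hX.meanCurv_mem s hs e he _ (e.map_target hy)
    rwa [e.right_inv hy] at this
  · have := hX.flow s hs e he _ (e.map_target hy)
    rwa [e.right_inv hy] at this
  · refine hconv s hs e he _ (e.map_target hy) lam ?_
    rwa [e.right_inv hy]
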